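/- **Setting.** Let $(A,\partial)$ be a commutative differential $\mathbb{Q}$-algebra (functions of $x$ and the times), with derivations $\partial_{t_{2m+1}}$, $m\ge 0$, commuting with $\partial$. Let $L=\partial+u_2\partial^{-1}+u_3\partial^{-2}+\cdots=\sum_{l\ge0}u_l\partial^{1-l}$ ($u_0=1$, $u_1=0$, $u_l\in A$) be a formal pseudo-differential operator with $L^*=-\partial^kL\partial^{-k}$, where $k=1$ (BKP hierarchy) or $k=0$ (CKP hierarchy), satisfying $L_{t_{2m+1}}=[(L^{2m+1})_+,L]$ for all $m\ge 0$. Let $n\ge0$ and suppose that $L$ satisfies the $(2n+1)$-reduction $L^{2n+1}=(L^{2n+1})_+$. Put $N=2n+1$ and $L^m=\sum_{j\le m}p_j(m)\partial^j$. *Nonlocal operators.* $\partial^{-1}$ is a two-sided inverse of $\partial$: we suppose that $u_2,u_3,\dots$ lie in an ideal $I$ of $A$ stable under $\partial$ and all $\partial_{t_{2m+1}}$, and that operators composed of $\partial$, $\partial^{-1}$ and multiplications by elements of $A$ act on an $A$-module $V$ with a bijective additive map $\partial:V\to V$ satisfying $\partial(av)=(\partial a)v+a\,\partial v$, together with an $A$-linear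 map $I\to V$ commuting with $\partial$, through which elements of $I$ are regarded as elements of $V$. (For example $V=I$, if $\partial$ is bijective on $I$, as for smooth functions that decay rapidly with all derivatives at $x\to-\infty$ and $\partial^{-1}=\int_{-\infty}^x$.) *KP recursion operator.* Write $C_a^b=a(a-1)\cdots(a-b+1)/b!$ and $$C_{j,\mu}=\sum_{l=\max(0,\mu)}^{N}C_{j-\mu}^{l-\mu}\,p_l^{(l-\mu)}(N),\qquad D_{j,s}=C_{j,s}-\sum_{\mu=0}^{N-s}C_{s+\mu}^{s}\,p_{s+\mu}(N)\partial^\mu .$$ Let $S=(C_{-a,b-a})$ of size $(N-1)\times(N-1)$; $T=(C_{-a,N-1+b-a})$ of size $(N-1)\times N$; $M$ the lower triangular $N\times N$ matrix with diagonal entries $-N\partial$ and entries $D_{-a,N-1+b-a}$ for $b<a$; and $\mathcal N$ the $N\times(N-1)$ matrix with entries $D_{-a,b-a}$ for $a\le b$ and $C_{-a,b-a}$ for $b<a$. Let $$O_{j,h}=\sum_{r=0}^{j-h}\bigl(C_{1-r}^{j-h-r}u_r\partial^{j-h-r}-C_{-h}^{j-h-r}u_r^{(j-h-r)}\bigr),$$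 and let $Q$ be the lower triangular $(N-1)\times(N-1)$ matrix with entries $O_{a+1,b}$, $b\le a$. Put $$R=S-TM^{-1}\mathcal N,\qquad \Phi(2n+1)=Q\,R\,Q^{-1}.$$ *The operators $B$.* For $1\le\mu\le l$ let $$B_{-2l,-2\mu+1}=\sum_{\nu\ge0}\ \sum_{i_1,\dots,i_\nu}\Bigl(-\tfrac12\Bigr)^{\nu+1}\Bigl(\prod_{\gamma=1}^{\nu}C_{2l-1+k-i_1-\cdots-i_{\gamma-1}}^{i_\gamma}\Bigr)C_{2l-1+k-i_1-\cdots-i_\nu}^{2l-2\mu+1-i_1-\cdots-i_\nu}\ \partial^{2l-2\mu+1},$$ the inner sum being over positive even integers $i_1,\dots,i_\nu$ with $i_1+\cdots+i_\nu\le 2l-2\mu$. **Theorem.** The matrices $M$ and $Q$ are invertible. Let $\widehat\Phi(2n+1)$ be the $n\times n$ matrix of operators with entries $$\widehat\Phi(2n+1)_{a,\mu}=(\Phi^2(2n+1))_{2a-1,2\mu-1}+\sum_{i=\mu}^{n}(\Phi^2(2n+1))_{2a-1,2i}\,B_{-2i,-2\mu+1},\qquad 1\le a,\mu\le n .$$ Then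 $\widehat\Phi(2n+1)$ is a recursion operator of the $(2n+1)$-reduced BKP ($k=1$) and CKP ($k=0$) hierarchies: for $\widehat U=(u_2,u_4,\dots,u_{2n})^t$ and all $m,p\ge0$, $$\widehat U_{t_{2m+1+2p(2n+1)}}=\widehat\Phi(2n+1)^p\,\widehat U_{t_{2m+1}}\quad\text{in }V^n .$$ -/

import Mathlib

noncomputable section

namespace BCKP

/-! ### Formal pseudo-differential operators -/

/-- A formal pseudo-differential operator `∑_{j ≤ N} p_j ∂^j` with coefficients in the
differential algebra `(A, δ)`. The field `coeff j` is `p_j`. -/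
structure PsiDO {A : Type*} [CommRing A] [Algebra ℚ A] (δ : Derivation ℚ A A) where
  coeff : ℤ → A
  bdd : ∃ N : ℤ, ∀ j : ℤ, N < j → coeff j = 0

namespace PsiDO

variable {A : Type*} [CommRing A] [Algebra ℚ A] {δ : Derivation ℚ A A}

/-- The operator `∂^k`, for `k` an integer. -/
def dpow (δ : Derivation ℚ A A) (k : ℤ) : PsiDO δ where
  coeff j := if j = k then 1 else 0
  bdd := ⟨k, fun _ hj => if_neg hj.ne'⟩

instance : One (PsiDO δ) := ⟨dpow δ 0⟩

instance : Neg (PsiDO δ) :=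
  ⟨fun P =>
    { coeff := fun j => -P.coeff j
      bdd := by
        obtain ⟨N, hN⟩ := P.bdd
        exact ⟨N, fun j hj => by rw [hN j hj, neg_zero]⟩ }⟩

instance : Sub (PsiDO δ) :=
  ⟨fun P Q =>
    { coeff := fun j => P.coeff j - Q.coeff j
      bdd := by
        obtain ⟨N, hN⟩ := P.bdd
        obtain ⟨M, hM⟩ := Q.bdd
        refine ⟨max N M, fun j hj => ?_⟩
        rw [hN j (lt_of_le_of_lt (le_max_left _ _) hj),
          hM j (lt_of_le_of_lt (le_max_right _ _) hj), sub_zero] }⟩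

/-- The product determined by `∂^i ∘ q = ∑_{k ≥ 0} C(i,k) q^{(k)} ∂^{i-k}`, that is
`(∑ p_i ∂^i)(∑ q_l ∂^l) = ∑_{i,l} ∑_{k ≥ 0} C(i,k) p_i q_l^{(k)} ∂^{i+l-k}`.
In the coefficient of `∂^j` one has `l = j - i + k`; only finitely many terms are nonzero. -/
instance : Mul (PsiDO δ) :=
  ⟨fun P Q =>
    { coeff := fun j => ∑ᶠ x : ℤ × ℕ,
        Ring.choose x.1 x.2 • (P.coeff x.1 * δ^[x.2] (Q.coeff (j - x.1 + x.2)))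
      bdd := by
        obtain ⟨N, hN⟩ := P.bdd
        obtain ⟨M, hM⟩ := Q.bdd
        refine ⟨N + M, fun j hj => finsum_eq_zero_of_forall_eq_zero fun x => ?_⟩
        by_cases hx : N < x.1
        · rw [hN _ hx, zero_mul, smul_zero]
        · rw [hM _ (by omega), iterate_map_zero, mul_zero, smul_zero] }⟩

/-- Powers `P^m`, with `P^0 = 1` and `P^(m+1) = P^m * P`. -/
instance : Pow (PsiDO δ) ℕ := ⟨fun P m => npowRec m P⟩

/-- The nonnegative projection `P_+ = ∑_{j ≥ 0} p_j ∂^j`. -/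
def nonnegPart (P : PsiDO δ) : PsiDO δ where
  coeff j := if 0 ≤ j then P.coeff j else 0
  bdd := by
    obtain ⟨N, hN⟩ := P.bdd
    exact ⟨N, fun j hj => by rw [hN j hj, ite_self]⟩

/-- The formal adjoint `P^* = ∑_j (-1)^j ∂^j ∘ p_j`; the coefficient of `∂^i` is
`∑_{k ≥ 0} (-1)^{i+k} C(i+k,k) p_{i+k}^{(k)}`. -/
def adjoint (P : PsiDO δ) : PsiDO δ where
  coeff i := ∑ᶠ k : ℕ,
    ((Int.negOnePow (i + k) : ℤ) * Ring.choose (i + k) k) • δ^[k] (P.coeff (i + k))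
  bdd := by
    obtain ⟨N, hN⟩ := P.bdd
    refine ⟨N, fun j hj => finsum_eq_zero_of_forall_eq_zero fun k => ?_⟩
    rw [hN _ (by omega), iterate_map_zero, smul_zero]

/-- The Lax operator `L = ∑_{l ≥ 0} u_l ∂^{1-l}`. -/
def lax (δ : Derivation ℚ A A) (u : ℕ → A) : PsiDO δ where
  coeff j := if j ≤ 1 then u (1 - j).toNat else 0
  bdd := ⟨1, fun _ hj => if_neg (not_le.mpr hj)⟩

end PsiDO

/-! ### Modules on which nonlocal operators act -/

/-- Data that give a meaning to nonlocal operators (operators composed of multiplications, `∂` and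
`∂⁻¹`) applied to elements of an ideal `I` of the differential algebra `(A, δ)`: an additive
endomorphism `D` of an `A`-module `V` that satisfies the Leibniz rule and is bijective, so that
`∂⁻¹` acts on `V`, and an `A`-linear map `ι : I → V` under which `D` restricts to `δ`.
The basic case is `V = I` and `ι = id`, when `δ` is bijective on `I`: for instance smooth functions
that decay rapidly, with all derivatives, as `x → -∞`, where `∂⁻¹` is `∫_{-∞}^x`. -/
structure NonlocalModule {A : Type*} [CommRing A] [Algebra ℚ A] (δ : Derivation ℚ A A)
    (I : Ideal A) (V : Type*) [AddCommGroup V] [Module A V] where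
  D : AddMonoid.End V
  D_smul : ∀ (a : A) (v : V), D (a • v) = δ a • v + a • D v
  D_bijective : Function.Bijective D
  ι : I →ₗ[A] V
  ι_deriv : ∀ f g : I, (g : A) = δ (f : A) → ι g = D (ι f)

/-! ### The recursion operator of the KP hierarchy under the `(r+1)`-reduction -/

section Operators

variable {A : Type*} [CommRing A] [Algebra ℚ A] {δ : Derivation ℚ A A}
  {V : Type*} [AddCommGroup V] [Module A V]

/-- Multiplication by `a`, as an operator on `V`. -/
def mulOp (V : Type*) [AddCommGroup V] [Module A V] (a : A) : AddMonoid.End V :=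
  Module.toAddMonoidEnd A V a

/-- `p_j(m)`, the coefficient of `∂^j` in `L^m`. -/
def pCoeff (L : PsiDO δ) (j : ℤ) (m : ℕ) : A := (L ^ m).coeff j

/-- `C_{j,μ}(N) = ∑_{l = max(0,μ)}^N C(j-μ, l-μ) p_l(N)^{(l-μ)}`. -/
def cCoeff (L : PsiDO δ) (N : ℕ) (j μ : ℤ) : A :=
  ∑ l ∈ Finset.Icc (max 0 μ) (N : ℤ),
    Ring.choose (j - μ) (l - μ).toNat • δ^[(l - μ).toNat] (pCoeff L l N)

/-- `C̃_s(N) = ∑_{μ=0}^{N-s} C(s+μ, s) p_{s+μ}(N) ∂^μ`. -/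
def cTilde (L : PsiDO δ) (D : AddMonoid.End V) (N s : ℕ) : AddMonoid.End V :=
  ∑ μ ∈ Finset.range (N - s + 1),
    mulOp V ((s + μ).choose s • pCoeff L ((s + μ : ℕ) : ℤ) N) * D ^ μ

/-- `D_{j,s}(N) = C_{j,s}(N) - C̃_s(N)`. -/
def dOp (L : PsiDO δ) (D : AddMonoid.End V) (N : ℕ) (j : ℤ) (s : ℕ) : AddMonoid.End V :=
  mulOp V (cCoeff L N j s) - cTilde L D N s

/-- The `(N-1) × (N-1)` matrix `S(N)`, `N = r + 1`; its `(a,b)` entry (counted from `1`) is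
`C_{-a,b-a}(N)`. All matrix indices below are counted from `0` in the code. -/
def matS (L : PsiDO δ) (V : Type*) [AddCommGroup V] [Module A V] (r : ℕ) :
    Matrix (Fin r) (Fin r) (AddMonoid.End V) :=
  Matrix.of fun a b => mulOp V (cCoeff L (r + 1) (-((a : ℤ) + 1)) ((b : ℤ) - a))

/-- The `(N-1) × N` matrix `T(N)`, `N = r + 1`; its `(a,b)` entry (counted from `1`) is
`C_{-a,N-1+b-a}(N)`, which vanishes for `N - 1 + b - a > N`. -/
def matT (L : PsiDO δ) (V : Type*) [AddCommGroup V] [Module A V] (r : ℕ) :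
    Matrix (Fin r) (Fin (r + 1)) (AddMonoid.End V) :=
  Matrix.of fun a b => mulOp V (cCoeff L (r + 1) (-((a : ℤ) + 1)) ((r : ℤ) + b - a))

/-- The lower triangular `N × N` matrix `M(N)`, `N = r + 1`, with diagonal entries `-N ∂` and
`(a,b)` entry (counted from `1`) `D_{-a,N-1+b-a}(N)` for `b < a`. -/
def matM (L : PsiDO δ) (D : AddMonoid.End V) (r : ℕ) :
    Matrix (Fin (r + 1)) (Fin (r + 1)) (AddMonoid.End V) :=
  Matrix.of fun a b =>
    if a = b then -((r + 1) • D)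
    else if b < a then dOp L D (r + 1) (-((a : ℤ) + 1)) (r + (b : ℕ) - (a : ℕ))
    else 0

/-- The `N × (N-1)` matrix `N(N)`, `N = r + 1`; its `(a,b)` entry (counted from `1`) is
`D_{-a,b-a}(N)` for `a ≤ b` and `C_{-a,b-a}(N)` for `b < a`. -/
def matN (L : PsiDO δ) (D : AddMonoid.End V) (r : ℕ) :
    Matrix (Fin (r + 1)) (Fin r) (AddMonoid.End V) :=
  Matrix.of fun a b =>
    if (a : ℕ) ≤ (b : ℕ) then dOp L D (r + 1) (-((a : ℤ) + 1)) ((b : ℕ) - (a : ℕ))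
    else mulOp V (cCoeff L (r + 1) (-((a : ℤ) + 1)) ((b : ℤ) - a))

/-- `R(N) = S(N) - T(N) M(N)⁻¹ N(N)`, `N = r + 1`. -/
def matR (L : PsiDO δ) (D : AddMonoid.End V) (r : ℕ) :
    Matrix (Fin r) (Fin r) (AddMonoid.End V) :=
  matS L V r - matT L V r * Ring.inverse (matM L D r) * matN L D r

/-- `O_{j,h} = ∑_{i=0}^{j-h} (C(1-i, j-h-i) u_i ∂^{j-h-i} - C(-h, j-h-i) u_i^{(j-h-i)})`,
where `u_i` is the coefficient of `∂^{1-i}` in `L`. -/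
def oOp (L : PsiDO δ) (D : AddMonoid.End V) (j h : ℕ) : AddMonoid.End V :=
  ∑ i ∈ Finset.range (j - h + 1),
    (mulOp V (Ring.choose (1 - (i : ℤ)) (j - h - i) • L.coeff (1 - i)) * D ^ (j - h - i)
      - mulOp V (Ring.choose (-(h : ℤ)) (j - h - i) • δ^[j - h - i] (L.coeff (1 - i))))

/-- The lower triangular `(N-1) × (N-1)` matrix `Q(N)`, `N = r + 1`, through which the flows of
the KP hierarchy are expressed by `U(N)_{t_m} = Q(N) (p_{-1}(m), …, p_{-N+1}(m))^t`; its `(a,b)`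
entry (counted from `1`) is `O_{a+1,b}`. -/
def matQ (L : PsiDO δ) (D : AddMonoid.End V) (r : ℕ) :
    Matrix (Fin r) (Fin r) (AddMonoid.End V) :=
  Matrix.of fun a b => if b ≤ a then oOp L D ((a : ℕ) + 2) ((b : ℕ) + 1) else 0

/-- The recursion operator `Φ(N) = Q(N) R(N) Q(N)⁻¹` of the KP hierarchy, `N = r + 1`. -/
def matPhi (L : PsiDO δ) (D : AddMonoid.End V) (r : ℕ) :
    Matrix (Fin r) (Fin r) (AddMonoid.End V) :=
  matQ L D r * matR L D r * Ring.inverse (matQ L D r)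

/-! ### The recursion operator of the BKP and CKP hierarchies -/

/-- The coefficient of `∂^{2l-2μ+1}` in `B_{-2l,-2μ+1}`: the sum, over all finite sequences
`i_1, …, i_ν` (`ν ≥ 0`) of positive even numbers with `i_1 + ⋯ + i_ν ≤ 2l - 2μ`, of
`(-1/2)^{ν+1} ∏_γ C(2l-1+k-i_1-⋯-i_{γ-1}, i_γ) · C(2l-1+k-i_1-⋯-i_ν, 2l-2μ+1-i_1-⋯-i_ν)`.
The sequence `i` is twice the sequence of blocks of a composition `c` of `s`, `0 ≤ s ≤ l - μ`. -/
def bCoeff (k l μ : ℕ) : ℚ :=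
  ∑ s ∈ Finset.range (l - μ + 1), ∑ c : Composition s,
    (-1 / 2 : ℚ) ^ (c.length + 1)
      * (∏ γ : Fin c.length,
          ((2 * l - 1 + k - 2 * c.sizeUpTo γ).choose (2 * c.blocksFun γ) : ℚ))
      * ((2 * l - 1 + k - 2 * s).choose (2 * l - 2 * μ + 1 - 2 * s) : ℚ)

/-- The operator `B_{-2l,-2μ+1}`, for CKP if `k = 0` and for BKP if `k = 1` (`1 ≤ μ ≤ l`). -/
def bOp (A : Type*) [CommRing A] [Algebra ℚ A] [Module A V] (D : AddMonoid.End V)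
    (k l μ : ℕ) : AddMonoid.End V :=
  mulOp V (algebraMap ℚ A (bCoeff k l μ)) * D ^ (2 * l - 2 * μ + 1)

/-- The `n × n` matrix `Φ̂(2n+1)`; its `(a,μ)` entry (counted from `1`) is
`(Φ(2n+1)²)_{2a-1,2μ-1} + ∑_{i=μ}^n (Φ(2n+1)²)_{2a-1,2i} B_{-2i,-2μ+1}`. -/
def matPhiHat (k : ℕ) (L : PsiDO δ) (D : AddMonoid.End V) (n : ℕ) :
    Matrix (Fin n) (Fin n) (AddMonoid.End V) :=
  Matrix.of fun a μ =>
    (matPhi L D (2 * n) ^ 2) ⟨2 * a, by omega⟩ ⟨2 * μ, by omega⟩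
      + ∑ i ∈ Finset.Ici μ,
          (matPhi L D (2 * n) ^ 2) ⟨2 * a, by omega⟩ ⟨2 * i + 1, by omega⟩
            * bOp A D k ((i : ℕ) + 1) ((μ : ℕ) + 1)

end Operators

end BCKP

end

open Finset

/-! Write `N = 2n+1` and let `x_m` be the vector of the coefficients of `∂^(-1), …, ∂^(-N+1)` in
`L^m`, and `y_m` that of the next `N` coefficients.

By the reduction `L^N` is a differential operator, so the negative coefficients of `L^m L^N` and of
`L^N L^m` depend linearly on those of `L^m` (`coeff_mul_pow_eq_sum`, `coeff_pow_mul_eq_sum`). The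
first product gives `x_(m+N) = S x_m + T y_m`. Both products equal `L^(m+N)`; equating them gives
the linear system `𝒩 x_m + M y_m = 0`. The matrix `M` is triangular with `-N∂` on the diagonal,
hence invertible, and eliminating `y_m` yields `x_(m+N) = R x_m` (`actVec_matR`).

Since `L^m` commutes with `L`, `[(L^m)_+, L] = [L, (L^m)_-]`, whose coefficients are `Q x_m`
(`coeff_nonnegPart_comm`, `rep_comm_nonnegPart`). So `Φ = Q R Q⁻¹` sends `Q x_m` to `Q x_(m+N)`. As
`N` is odd, one step turns an odd exponent into an even one, which carries no flow here; two steps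
return to an odd exponent, and `Φ²` acts on the flows of `(u_2, …, u_(2n+1))`.

The condition on `L^*` determines each `u_(2l+1)` as a constant-coefficient differential expression
in `u_2, …, u_(2l)`, with the operators `B` as coefficients (`coeff_even_eq`). These expressions
commute with the time derivations, so substituting them into the rows of `Φ²` that belong to `u_2,
u_4, …` gives the reduced operator (`actVec_matPhiHat`).

Products of operators are only given by coefficient formulas, so associativity (`PsiDO.mul_assoc`),
on which `L^m L^N = L^N L^m` rests, has to be proved as well. -/

theorem Derivation.iterate_mul {R A : Type*} [CommRing R] [CommRing A] [Algebra R A]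
    (D : Derivation R A A) (n : ℕ) (a b : A) :
    D^[n] (a * b) = ∑ ij ∈ antidiagonal n, n.choose ij.1 • (D^[ij.1] a * D^[ij.2] b) := by
  induction n with
  | zero => simp
  | succ n ih =>
    rw [sum_antidiagonal_choose_succ_nsmul (M := A) (fun i j => (D^[i] a * D^[j] b)) n]
    simp only [Function.iterate_succ_apply', ih, map_sum, map_nsmul, Derivation.leibniz, smul_add,
      smul_eq_mul, sum_add_distrib]
    rw [add_left_cancel_iff]
    refine sum_congr rfl fun ⟨i, j⟩ hij ↦ ?_
    rw [n.choose_symm_of_eq_add (HasAntidiagonal.mem_antidiagonal.1 hij).symm, mul_comm]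

/-! ### Composition of formal pseudo-differential operators -/

namespace BCKP

variable {A : Type*} [CommRing A] [Algebra ℚ A] {δ : Derivation ℚ A A}

@[ext] theorem PsiDO.ext {P Q : PsiDO δ} (h : ∀ j, P.coeff j = Q.coeff j) : P = Q := by
  cases P; cases Q; congr; exact funext h

/-- The coefficient of `∂^j` in the product `a ∂^i ∘ b ∂^l`. -/
def monoMul (δ : Derivation ℚ A A) (a : A) (i : ℤ) (b : A) (l j : ℤ) : A :=
  if j ≤ i + l then Ring.choose i (i + l - j).toNat • (a * δ^[(i + l - j).toNat] b) else 0

theorem monoMul_of_lt {a b : A} {i l j : ℤ} (h : i + l < j) : monoMul δ a i b l j = 0 :=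
  if_neg (not_le.2 h)

theorem monoMul_of_eq {a b : A} {i l j : ℤ} (k : ℕ) (h : i + l = j + k) :
    monoMul δ a i b l j = Ring.choose i k • (a * δ^[k] b) := by
  rw [monoMul, if_pos (by omega), show (i + l - j).toNat = k by omega]

@[simp] theorem monoMul_zero_left {b : A} {i l j : ℤ} : monoMul δ 0 i b l j = 0 := by
  simp [monoMul]

@[simp] theorem monoMul_zero_right {a : A} {i l j : ℤ} : monoMul δ a i 0 l j = 0 := by
  simp [monoMul]

theorem monoMul_sum_left {ι : Type*} (s : Finset ι) (f : ι → A) {b : A} {i l j : ℤ} :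
    monoMul δ (∑ x ∈ s, f x) i b l j = ∑ x ∈ s, monoMul δ (f x) i b l j := by
  unfold monoMul
  split_ifs
  · rw [sum_mul, smul_sum]
  · simp

theorem iterate_map_finset_sum {ι : Type*} (n : ℕ) (s : Finset ι) (f : ι → A) :
    δ^[n] (∑ x ∈ s, f x) = ∑ x ∈ s, δ^[n] (f x) := by
  induction n generalizing f with
  | zero => rfl
  | succ n ih => simp only [Function.iterate_succ_apply, map_sum, ih]

theorem monoMul_sum_right {ι : Type*} (s : Finset ι) (f : ι → A) {a : A} {i l j : ℤ} :
    monoMul δ a i (∑ x ∈ s, f x) l j = ∑ x ∈ s, monoMul δ a i (f x) l j := by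
  unfold monoMul
  split_ifs
  · rw [iterate_map_finset_sum, mul_sum, smul_sum]
  · simp

/-- The coefficients of a product as finite sums. -/
theorem coeff_mul_eq_sum (P Q : PsiDO δ) {N M c j : ℤ} (hP : ∀ i, N < i → P.coeff i = 0)
    (hQ : ∀ i, M < i → Q.coeff i = 0) (hc : c ≤ j - M) (hc' : c ≤ j - N) :
    (P * Q).coeff j =
      ∑ i ∈ Icc c N, ∑ l ∈ Icc c M, monoMul δ (P.coeff i) i (Q.coeff l) l j := by
  change ∑ᶠ x : ℤ × ℕ,
        Ring.choose x.1 x.2 • (P.coeff x.1 * δ^[x.2] (Q.coeff (j - x.1 + x.2))) = _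
  rw [finsum_eq_sum_of_support_subset (s := Icc c N ×ˢ range (N + M - j).toNat.succ), sum_product]
  · refine sum_congr rfl fun i hi => ?_
    rw [mem_Icc] at hi
    refine sum_bij_ne_zero (fun k _ _ => j - i + k) ?_ ?_ ?_ ?_
    · intro k hk h
      rw [mem_Icc]
      refine ⟨by omega, ?_⟩
      by_contra hlt
      rw [hQ _ (by omega), iterate_map_zero, mul_zero, smul_zero] at h
      exact h rfl
    · intros; omega
    · intro l hl h
      rw [mem_Icc] at hl
      have hj : j ≤ i + l := by
        by_contra hlt
        exact h (monoMul_of_lt (by omega))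
      refine ⟨(i + l - j).toNat, by rw [mem_range]; omega, ?_, by omega⟩
      rw [monoMul, if_pos hj] at h
      rwa [show j - i + ((i + l - j).toNat : ℤ) = l by omega]
    · intro k hk h
      rw [monoMul_of_eq k (by omega)]
  · intro x hx
    rw [Function.mem_support] at hx
    rw [coe_product, Set.mem_prod, mem_coe, mem_coe, mem_Icc, mem_range]
    have h1 : x.1 ≤ N := by
      by_contra h
      rw [hP _ (by omega), zero_mul, smul_zero] at hx
      exact hx rfl
    have h2 : j - x.1 + x.2 ≤ M := by
      by_contra h
      rw [hQ _ (by omega), iterate_map_zero, mul_zero, smul_zero] at hx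
      exact hx rfl
    omega

theorem coeff_mul_eq_zero (P Q : PsiDO δ) {N M j : ℤ} (hP : ∀ i, N < i → P.coeff i = 0)
    (hQ : ∀ i, M < i → Q.coeff i = 0) (hj : N + M < j) : (P * Q).coeff j = 0 := by
  rw [coeff_mul_eq_sum P Q hP hQ (le_min_iff.1 le_rfl).1 (le_min_iff.1 le_rfl).2]
  refine sum_eq_zero fun i hi => sum_eq_zero fun l hl => monoMul_of_lt ?_
  rw [mem_Icc] at hi hl
  omega

theorem coeff_mul_top (P Q : PsiDO δ) {N M : ℤ} (hP : ∀ i, N < i → P.coeff i = 0)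
    (hQ : ∀ i, M < i → Q.coeff i = 0) : (P * Q).coeff (N + M) = P.coeff N * Q.coeff M := by
  rw [coeff_mul_eq_sum P Q hP hQ (c := min N M) (by omega) (by omega),
    sum_eq_single_of_mem N (by simp), sum_eq_single_of_mem M (by simp), monoMul_of_eq 0 (by simp)]
  · simp
  · intro l hl h
    rw [mem_Icc] at hl
    exact monoMul_of_lt (by omega)
  · intro i hi h
    refine sum_eq_zero fun l hl => monoMul_of_lt ?_
    rw [mem_Icc] at hi hl
    omega

theorem choose_mul_choose_eq (i : ℤ) (s k : ℕ) :
    Ring.choose i (s + k) * ((s + k).choose s : ℤ) = Ring.choose i s * Ring.choose (i - s) k := by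
  have := Ring.choose_smul_choose i (Nat.le_add_right s k)
  rw [Nat.add_sub_cancel_left, nsmul_eq_mul] at this
  rw [← this, mul_comm]

theorem sum_antidiagonal_assoc {M : Type*} [AddCommMonoid M] (n : ℕ) (f : ℕ → ℕ → ℕ → M) :
    ∑ x ∈ antidiagonal n, ∑ y ∈ antidiagonal x.1, f y.1 y.2 x.2 =
      ∑ x ∈ antidiagonal n, ∑ y ∈ antidiagonal x.2, f x.1 y.1 y.2 := by
  rw [sum_sigma', sum_sigma']
  refine sum_bij' (fun x _ => ⟨(x.2.1, x.2.2 + x.1.2), (x.2.2, x.1.2)⟩)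
    (fun x _ => ⟨(x.1.1 + x.2.1, x.2.2), (x.1.1, x.2.1)⟩) ?_ ?_ ?_ ?_ ?_
  all_goals
    rintro ⟨⟨a, b⟩, ⟨c, d⟩⟩ h
    simp only [mem_sigma, HasAntidiagonal.mem_antidiagonal] at h ⊢
  · exact ⟨by omega, trivial⟩
  · exact ⟨by omega, trivial⟩
  · obtain ⟨h1, rfl⟩ := h; rfl
  · obtain ⟨h1, rfl⟩ := h; rfl

/-- Associativity for three monomials. The Leibniz rule distributes the derivatives falling on `b
c^(t)`; then `C(i, s+k) C(s+k, s) = C(i, s) C(i-s, k)`, and the Vandermonde identity for `(i-s) + l`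
sums over the derivatives of `c`. -/
theorem sum_choose_mul_eq (a b c : A) (i l : ℤ) (n : ℕ) :
    ∑ x ∈ antidiagonal n, Ring.choose i x.1 • (a * δ^[x.1] (Ring.choose l x.2 • (b * δ^[x.2] c))) =
    ∑ x ∈ antidiagonal n, Ring.choose (i + l - x.1) x.2 •
      (Ring.choose i x.1 • (a * δ^[x.1] b) * δ^[x.2] c) := by
  have h1 : ∀ x ∈ antidiagonal n,
      Ring.choose i x.1 • (a * δ^[x.1] (Ring.choose l x.2 • (b * δ^[x.2] c))) =
      ∑ y ∈ antidiagonal x.1, (fun s k t : ℕ =>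
        (Ring.choose i (s + k) * ((s + k).choose s : ℤ) * Ring.choose l t) •
        (a * δ^[s] b * δ^[k + t] c)) y.1 y.2 x.2 := by
    intro x hx
    have h : ∀ (k : ℕ) (z : ℤ) (v : A), δ^[k] (z • v) = z • δ^[k] v := fun k z v => by
      induction k with
      | zero => rfl
      | succ k ih => rw [Function.iterate_succ_apply', ih, map_zsmul, Function.iterate_succ_apply']
    rw [h, Derivation.iterate_mul, smul_sum, mul_sum, smul_sum]
    refine sum_congr rfl fun y hy => ?_
    rw [HasAntidiagonal.mem_antidiagonal] at hy
    simp only [← hy, Function.iterate_add_apply, zsmul_eq_mul, nsmul_eq_mul]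
    push_cast
    ring
  rw [sum_congr rfl h1, sum_antidiagonal_assoc n (fun s k t : ℕ =>
        (Ring.choose i (s + k) * ((s + k).choose s : ℤ) * Ring.choose l t) •
        (a * δ^[s] b * δ^[k + t] c))]
  refine sum_congr rfl fun x _ => ?_
  rw [show i + l - x.1 = (i - x.1) + l by ring, Ring.add_choose_eq _ (Commute.all _ _), sum_smul]
  refine sum_congr rfl fun y hy => ?_
  rw [HasAntidiagonal.mem_antidiagonal] at hy
  simp only [choose_mul_choose_eq, hy, zsmul_eq_mul]
  push_cast
  ring

theorem sum_eq_sum_antidiagonal {M : Type*} [AddCommMonoid M] {x c d : ℤ} {n : ℕ}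
    (f : ℤ → M) (hc : c ≤ x) (hd : x + n ≤ d) (hf : ∀ e, e < x ∨ x + n < e → f e = 0) :
    ∑ e ∈ Icc c d, f e = ∑ z ∈ antidiagonal n, f (x + z.2) := by
  rw [Finset.Nat.sum_antidiagonal_eq_sum_range_succ_mk, ← sum_range_reflect]
  symm
  refine sum_bij_ne_zero (fun k _ _ => x + k) ?_ ?_ ?_ ?_
  · intro k hk _
    rw [mem_range] at hk
    rw [mem_Icc]; omega
  · intros; omega
  · intro e he h
    have : ¬ (e < x ∨ x + n < e) := fun h' => h (hf e h')
    refine ⟨(e - x).toNat, by rw [mem_range]; omega, ?_, by omega⟩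
    convert h using 2
    simp only [Nat.succ_eq_add_one]
    omega
  · intro k hk _
    rw [mem_range] at hk
    congr 1
    simp only [Nat.succ_eq_add_one]
    omega

/-- The number `n = i + l + h - j` of derivatives to be distributed is fixed, so only `n + 1`
intermediate orders matter on either side, and any interval containing them gives the same sum. -/
theorem monoMul_assoc (a b c : A) {i l h j c₁ d₁ c₂ d₂ : ℤ} (h1 : c₁ ≤ j - h) (h2 : i + l ≤ d₁)
    (h3 : c₂ ≤ j - i) (h4 : l + h ≤ d₂) :
    ∑ e ∈ Icc c₁ d₁, monoMul δ (monoMul δ a i b l e) e c h j =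
      ∑ f ∈ Icc c₂ d₂, monoMul δ a i (monoMul δ b l c h f) f j := by
  by_cases hj : i + l + h < j
  · rw [sum_eq_zero, sum_eq_zero]
    · intro f _
      by_cases hf : l + h < f
      · rw [monoMul_of_lt hf, monoMul_zero_right]
      · exact monoMul_of_lt (by omega)
    · intro f _
      by_cases hf : i + l < f
      · rw [monoMul_of_lt hf, monoMul_zero_left]
      · exact monoMul_of_lt (by omega)
  obtain ⟨n, hn⟩ : ∃ n : ℕ, i + l + h = j + n := ⟨(i + l + h - j).toNat, by omega⟩
  rw [sum_eq_sum_antidiagonal (x := j - h) (n := n) _ h1 (by omega),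
    sum_eq_sum_antidiagonal (x := j - i) (n := n) _ h3 (by omega)]
  · have e1 : ∀ x ∈ antidiagonal n, monoMul δ (monoMul δ a i b l (j - h + x.2)) (j - h + x.2) c h j
        = Ring.choose (i + l - x.1) x.2 • (Ring.choose i x.1 • (a * δ^[x.1] b) * δ^[x.2] c) := by
      intro x hx
      rw [HasAntidiagonal.mem_antidiagonal] at hx
      rw [monoMul_of_eq (i := i) x.1 (by omega), monoMul_of_eq x.2 (by omega)]
      congr 2
      omega
    have e2 : ∀ x ∈ antidiagonal n, monoMul δ a i (monoMul δ b l c h (j - i + x.2)) (j - i + x.2) j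
        = Ring.choose i x.2 • (a * δ^[x.2] (Ring.choose l x.1 • (b * δ^[x.1] c))) := by
      intro x hx
      rw [HasAntidiagonal.mem_antidiagonal] at hx
      rw [monoMul_of_eq (i := l) x.1 (by omega), monoMul_of_eq x.2 (by omega)]
    rw [sum_congr rfl e1, sum_congr rfl e2, ← sum_choose_mul_eq,
      ← Finset.Nat.sum_antidiagonal_swap]
    rfl
  · intro f hf
    by_cases hf : l + h < f
    · rw [monoMul_of_lt hf, monoMul_zero_right]
    · exact monoMul_of_lt (by omega)
  · intro f hf
    by_cases hf : i + l < f
    · rw [monoMul_of_lt hf, monoMul_zero_left]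
    · exact monoMul_of_lt (by omega)

theorem PsiDO.mul_assoc (P Q R : PsiDO δ) : P * Q * R = P * (Q * R) := by
  ext j
  obtain ⟨N₁, h₁⟩ := P.bdd
  obtain ⟨N₂, h₂⟩ := Q.bdd
  obtain ⟨N₃, h₃⟩ := R.bdd
  obtain ⟨N, hN⟩ : ∃ N : ℤ, N₁ ≤ N ∧ N₂ ≤ N ∧ N₃ ≤ N ∧ 0 ≤ N ∧ j ≤ N :=
    ⟨max N₁ (max N₂ (max N₃ (max 0 j))), by simp⟩
  have hP : ∀ i, N < i → P.coeff i = 0 := fun i hi => h₁ i (by omega)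
  have hQ : ∀ i, N < i → Q.coeff i = 0 := fun i hi => h₂ i (by omega)
  have hR : ∀ i, N < i → R.coeff i = 0 := fun i hi => h₃ i (by omega)
  have hPQ : ∀ i, 2 * N < i → (P * Q).coeff i = 0 :=
    fun i hi => coeff_mul_eq_zero P Q hP hQ (by omega)
  have hQR : ∀ i, 2 * N < i → (Q * R).coeff i = 0 :=
    fun i hi => coeff_mul_eq_zero Q R hQ hR (by omega)
  have key : ∀ e ∈ Icc (j - 2 * N) (2 * N), ∀ P Q : PsiDO δ, (∀ i, N < i → P.coeff i = 0) →
      (∀ i, N < i → Q.coeff i = 0) → (P * Q).coeff e =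
      ∑ i ∈ Icc (j - 3 * N) N, ∑ l ∈ Icc (j - 3 * N) N, monoMul δ (P.coeff i) i (Q.coeff l) l e := by
    intro e he P Q hP hQ
    rw [mem_Icc] at he
    exact coeff_mul_eq_sum P Q hP hQ (by omega) (by omega)
  have key1 : ∀ e < j - 2 * N, ∀ h ∈ Icc (j - 3 * N) N,
      monoMul δ ((P * Q).coeff e) e (R.coeff h) h j = 0 := by
    intro e he h hh
    rw [mem_Icc] at hh
    exact monoMul_of_lt (by omega)
  have key2 : ∀ e < j - 2 * N, ∀ h ∈ Icc (j - 3 * N) N,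
      monoMul δ (P.coeff h) h ((Q * R).coeff e) e j = 0 := by
    intro e he h hh
    rw [mem_Icc] at hh
    exact monoMul_of_lt (by omega)
  -- Intermediate orders below `j - 2N` contribute nothing. With them removed, the one lower bound
  -- `j - 3N` serves for the coefficients of all three factors, as `key` requires.
  have hsub : Icc (j - 2 * N) (2 * N) ⊆ Icc (j - 3 * N) (2 * N) := Icc_subset_Icc (by omega) le_rfl
  rw [coeff_mul_eq_sum (P * Q) R (c := j - 3 * N) hPQ hR (by omega) (by omega),
    coeff_mul_eq_sum P (Q * R) (c := j - 3 * N) hP hQR (by omega) (by omega),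
    sum_comm (s := Icc _ N) (t := Icc _ (2 * N)),
    ← sum_subset hsub fun e he he' => sum_eq_zero (key1 e (by rw [mem_Icc] at *; omega)),
    ← sum_subset hsub fun e he he' => sum_eq_zero (key2 e (by rw [mem_Icc] at *; omega))]
  trans ∑ i ∈ Icc (j - 3 * N) N, ∑ l ∈ Icc (j - 3 * N) N, ∑ h ∈ Icc (j - 3 * N) N,
    ∑ e ∈ Icc (j - 2 * N) (2 * N),
      monoMul δ (monoMul δ (P.coeff i) i (Q.coeff l) l e) e (R.coeff h) h j
  · have : ∀ e ∈ Icc (j - 2 * N) (2 * N), ∀ h ∈ Icc (j - 3 * N) N,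
        monoMul δ ((P * Q).coeff e) e (R.coeff h) h j =
        ∑ i ∈ Icc (j - 3 * N) N, ∑ l ∈ Icc (j - 3 * N) N,
          monoMul δ (monoMul δ (P.coeff i) i (Q.coeff l) l e) e (R.coeff h) h j := by
      intro e he h hh
      rw [key e he P Q hP hQ, monoMul_sum_left]
      exact sum_congr rfl fun i _ => monoMul_sum_left _ _
    rw [sum_congr rfl fun e he => sum_congr rfl (this e he), sum_comm]
    simp_rw [sum_comm (s := Icc (j - 2 * N) (2 * N))]
    rw [sum_comm]
    exact sum_congr rfl fun i _ => sum_comm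
  · have : ∀ e ∈ Icc (j - 2 * N) (2 * N), ∀ i ∈ Icc (j - 3 * N) N,
        monoMul δ (P.coeff i) i ((Q * R).coeff e) e j =
        ∑ l ∈ Icc (j - 3 * N) N, ∑ h ∈ Icc (j - 3 * N) N,
          monoMul δ (P.coeff i) i (monoMul δ (Q.coeff l) l (R.coeff h) h e) e j := by
      intro e he i hi
      rw [key e he Q R hQ hR, monoMul_sum_right]
      exact sum_congr rfl fun i _ => monoMul_sum_right _ _
    rw [sum_congr rfl fun e he => sum_congr rfl (this e he)]
    simp_rw [sum_comm (s := Icc (j - 2 * N) (2 * N))]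
    refine sum_congr rfl fun i hi => sum_congr rfl fun l hl => sum_congr rfl fun h hh => ?_
    rw [mem_Icc] at hi hl hh
    apply monoMul_assoc <;> omega

theorem PsiDO.one_mul (P : PsiDO δ) : 1 * P = P := by
  ext j
  change ∑ᶠ x : ℤ × ℕ,
        Ring.choose x.1 x.2 • ((if x.1 = 0 then 1 else 0) * δ^[x.2] (P.coeff (j - x.1 + x.2))) = _
  rw [finsum_eq_single _ (0, 0)]
  · simp
  · rintro ⟨i, k⟩ h
    by_cases hi : i = 0
    · subst hi
      obtain _ | k := k
      · exact absurd rfl h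
      · rw [Ring.choose_zero_succ, zero_smul]
    · simp [hi]

theorem PsiDO.coeff_mul_dpow (P : PsiDO δ) (c j : ℤ) :
    (P * PsiDO.dpow δ c).coeff j = P.coeff (j - c) := by
  change ∑ᶠ x : ℤ × ℕ, Ring.choose x.1 x.2 •
    (P.coeff x.1 * δ^[x.2] (if j - x.1 + x.2 = c then 1 else 0)) = _
  rw [finsum_eq_single _ (j - c, 0)]
  · simp
  · rintro ⟨i, k⟩ h
    obtain _ | k := k
    · have : ¬ j - i = c := fun hc => h (by rw [← hc]; simp)
      simp [this]
    · rw [Function.iterate_succ_apply]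
      split_ifs
      · simp
      · simp

theorem PsiDO.mul_one (P : PsiDO δ) : P * 1 = P := by
  ext j
  exact (P.coeff_mul_dpow 0 j).trans (by rw [sub_zero])

theorem PsiDO.coeff_dpow_one_mul (P : PsiDO δ) (j : ℤ) :
    (PsiDO.dpow δ 1 * P).coeff j = P.coeff (j - 1) + δ (P.coeff j) := by
  change ∑ᶠ x : ℤ × ℕ,
        Ring.choose x.1 x.2 • ((if x.1 = 1 then 1 else 0) * δ^[x.2] (P.coeff (j - x.1 + x.2))) = _
  rw [finsum_eq_sum_of_support_subset (s := {(1, 0), (1, 1)})]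
  · rw [sum_pair (by simp)]
    simp
  · rintro ⟨i, k⟩ h
    rw [Function.mem_support] at h
    by_cases hi : i = 1
    · subst hi
      match k with
      | 0 => simp
      | 1 => simp
      | k + 2 =>
        have : Ring.choose (1 : ℤ) (k + 2) = 0 := by
          have := Ring.choose_natCast (R := ℤ) 1 (k + 2)
          rw [Nat.choose_eq_zero_of_lt (by omega)] at this
          exact_mod_cast this
        simp [this] at h
    · simp [hi] at h

/-! ### Powers of the Lax operator -/

theorem PsiDO.pow_zero (P : PsiDO δ) : P ^ 0 = 1 := rfl

theorem PsiDO.pow_succ (P : PsiDO δ) (m : ℕ) : P ^ (m + 1) = P ^ m * P := rfl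

theorem PsiDO.pow_add (P : PsiDO δ) (m n : ℕ) : P ^ (m + n) = P ^ m * P ^ n := by
  induction n with
  | zero => rw [PsiDO.pow_zero, PsiDO.mul_one, Nat.add_zero]
  | succ n ih => rw [← Nat.add_assoc, PsiDO.pow_succ, PsiDO.pow_succ, ih, PsiDO.mul_assoc]

theorem PsiDO.pow_one (P : PsiDO δ) : P ^ 1 = P := by
  rw [PsiDO.pow_succ, PsiDO.pow_zero, PsiDO.one_mul]

theorem PsiDO.pow_mul_self (P : PsiDO δ) (m : ℕ) : P ^ m * P = P * P ^ m := by
  rw [← PsiDO.pow_succ, Nat.add_comm, PsiDO.pow_add, PsiDO.pow_one]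

theorem coeff_pow_eq_zero {L : PsiDO δ} (h1 : ∀ j, 1 < j → L.coeff j = 0) (m : ℕ) {j : ℤ}
    (hj : m < j) : (L ^ m).coeff j = 0 := by
  induction m generalizing j with
  | zero => exact if_neg (by simpa using hj.ne')
  | succ m ih =>
    rw [PsiDO.pow_succ]
    exact coeff_mul_eq_zero (N := m) (M := 1) _ _ (fun i hi => ih hi) h1 (by push_cast at hj; omega)

theorem coeff_pow_top {L : PsiDO δ} (h1 : ∀ j, 1 < j → L.coeff j = 0) (h1' : L.coeff 1 = 1)
    (m : ℕ) : (L ^ m).coeff m = 1 := by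
  induction m with
  | zero =>
    change (if ((0 : ℕ) : ℤ) = 0 then (1 : A) else 0) = 1
    simp
  | succ m ih =>
    rw [PsiDO.pow_succ, Nat.cast_succ,
      coeff_mul_top _ _ (fun i hi => coeff_pow_eq_zero h1 m hi) h1, ih, h1', _root_.mul_one]

theorem iterate_mem {I : Ideal A} (hδI : ∀ f ∈ I, δ f ∈ I) {f : A} (hf : f ∈ I) (k : ℕ) :
    δ^[k] f ∈ I := by
  induction k with
  | zero => exact hf
  | succ k ih => rw [Function.iterate_succ_apply']; exact hδI _ ih

/-- Modulo `I` the operator `L` is `∂`, so `L^m` is `∂^m` modulo `I`. This is what lets the negative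
coefficients of all powers be mapped to the module. -/
theorem coeff_pow_mem {L : PsiDO δ} {I : Ideal A} (hδI : ∀ f ∈ I, δ f ∈ I)
    (h1 : ∀ j, 1 < j → L.coeff j = 0) (h1' : L.coeff 1 = 1) (hI : ∀ j, j ≠ 1 → L.coeff j ∈ I)
    (m : ℕ) {j : ℤ} (hj : j ≠ m) : (L ^ m).coeff j ∈ I := by
  induction m generalizing j with
  | zero =>
    rw [show (L ^ 0).coeff j = 0 from if_neg (by simpa using hj)]
    exact I.zero_mem
  | succ m ih =>
    rw [PsiDO.pow_succ, coeff_mul_eq_sum (N := m) (M := 1) (c := min (j - 1) (j - m)) _ _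
      (fun i hi => coeff_pow_eq_zero h1 m hi) h1 (by omega) (by omega)]
    refine I.sum_mem fun i hi => I.sum_mem fun l hl => ?_
    unfold monoMul
    split_ifs with hjl
    · refine zsmul_mem ?_ _
      by_cases him : i = m
      · by_cases hl1 : l = 1
        -- Both coefficients are leading ones, but `j ≠ m + 1` puts at least one derivative on the
        -- constant `1`.
        · subst him hl1
          push_cast at hj
          obtain ⟨k, hk⟩ : ∃ k, ((m : ℤ) + 1 - j).toNat = k + 1 :=
            ⟨((m : ℤ) + 1 - j).toNat - 1, by omega⟩
          rw [hk, h1', Function.iterate_succ_apply, Derivation.map_one_eq_zero, iterate_map_zero,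
            mul_zero]
          exact I.zero_mem
        · exact I.mul_mem_left _ (iterate_mem hδI (hI l hl1) _)
      · exact I.mul_mem_right _ (ih him)
    · exact I.zero_mem

/-! ### Products with a differential operator, and the Lax commutator -/

theorem sum_Icc_eq_sum_range {M : Type*} [AddCommMonoid M] {c d : ℤ} (x : ℤ) (n : ℕ) {f : ℤ → M}
    (h : ∀ e, f e ≠ 0 → x ≤ e ∧ e < x + n) (h' : ∀ k < n, f (x + k) ≠ 0 → c ≤ x + k ∧ x + k ≤ d) :
    ∑ e ∈ Icc c d, f e = ∑ k ∈ range n, f (x + k) := by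
  symm
  refine sum_bij_ne_zero (fun k _ _ => x + k) ?_ ?_ ?_ ?_
  · intro k hk hf
    rw [mem_range] at hk
    rw [mem_Icc]
    exact h' k hk hf
  · intros; omega
  · intro e _ hf
    have := h e hf
    refine ⟨(e - x).toNat, by rw [mem_range]; omega, ?_, by omega⟩
    convert hf using 2
    omega
  · intros; rfl

theorem sum_Icc_eq_sum_range_sub {M : Type*} [AddCommMonoid M] {c d : ℤ} (x : ℤ) (n : ℕ)
    {f : ℤ → M} (h : ∀ e, c ≤ e → e ≤ d → f e ≠ 0 → e ≤ x ∧ x < e + n)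
    (h' : ∀ k < n, f (x - k) ≠ 0 → c ≤ x - k ∧ x - k ≤ d) :
    ∑ e ∈ Icc c d, f e = ∑ k ∈ range n, f (x - k) := by
  symm
  refine sum_bij_ne_zero (fun k _ _ => x - k) ?_ ?_ ?_ ?_
  · intro k hk hf
    rw [mem_range] at hk
    rw [mem_Icc]
    exact h' k hk hf
  · intros; omega
  · intro e he hf
    rw [mem_Icc] at he
    have := h e he.1 he.2 hf
    refine ⟨(x - e).toNat, by rw [mem_range]; omega, ?_, by omega⟩
    convert hf using 2
    omega
  · intros; rfl

theorem choose_natCast_eq_zero {i : ℤ} {k : ℕ} (hi : 0 ≤ i) (hk : i < k) :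
    Ring.choose i k = 0 := by
  lift i to ℕ using hi
  rw [Ring.choose_natCast, Nat.choose_eq_zero_of_lt (by omega), Nat.cast_zero]

/-- Multiplication on the right by a differential operator of order `N`. -/
theorem coeff_mul_pow_eq_sum {L P : PsiDO δ} {N : ℕ} {M : ℤ} (hP : ∀ i, M < i → P.coeff i = 0)
    (hN : ∀ i : ℤ, N < i → (L ^ N).coeff i = 0) (hN' : ∀ i : ℤ, i < 0 → (L ^ N).coeff i = 0)
    {a : ℕ} (ha : a < N) :
    (P * L ^ N).coeff (-((a : ℤ) + 1)) = ∑ b ∈ range (2 * N),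
      cCoeff L N (-((a : ℤ) + 1)) ((b : ℤ) - a) * P.coeff (-((b : ℤ) + 1)) := by
  obtain ⟨M', hM, hM'⟩ : ∃ M' : ℤ, M ≤ M' ∧ 0 ≤ M' := ⟨max M 0, by simp⟩
  have hP' : ∀ i, M' < i → P.coeff i = 0 := fun i hi => hP i (by omega)
  rw [coeff_mul_eq_sum P (L ^ N) (c := -2 * N - M') hP' hN (by omega) (by omega),
    sum_Icc_eq_sum_range_sub (-1) (2 * N)]
  · refine sum_congr rfl fun b _ => ?_
    rw [show (-1 - b : ℤ) = -(b + 1) by ring, cCoeff, sum_mul]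
    symm
    refine Eq.trans ?_ (sum_subset (s₁ := Icc (max 0 ((b : ℤ) - a)) N) ?_ ?_)
    · refine sum_congr rfl fun l hl => ?_
      rw [mem_Icc] at hl
      rw [monoMul_of_eq (l - (b - a)).toNat (by omega),
        show -((a : ℤ) + 1) - (b - a) = -(b + 1) by ring, pCoeff, smul_mul_assoc,
        mul_comm (P.coeff _)]
    · exact Icc_subset_Icc (by omega) le_rfl
    · intro l hl hl'
      rw [mem_Icc] at hl hl'
      by_cases h0 : l < 0
      · rw [hN' l h0, monoMul_zero_right]
      · exact monoMul_of_lt (by omega)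
  · intro i hi hi' h
    by_contra hcon
    refine h (sum_eq_zero fun l hl => ?_)
    rw [mem_Icc] at hl
    -- A nonnegative power of `∂` times a differential operator has no negative part, since `C(i, k)
    -- = 0` for `0 ≤ i < k`. Orders `i < -2N` are too low to reach `-(a+1)` with `a < N`.
    by_cases hi0 : 0 ≤ i
    · by_cases hl0 : l < 0
      · rw [hN' l hl0, monoMul_zero_right]
      · rw [monoMul, if_pos (by omega), choose_natCast_eq_zero hi0 (by omega), zero_smul]
    · exact monoMul_of_lt (by omega)
  · intro k hk _
    omega

/-- Multiplication on the left by a differential operator of order `N`. -/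
theorem coeff_pow_mul_eq_sum {L P : PsiDO δ} {N : ℕ} {M : ℤ} (hP : ∀ i, M < i → P.coeff i = 0)
    (hN : ∀ i : ℤ, N < i → (L ^ N).coeff i = 0) (hN' : ∀ i : ℤ, i < 0 → (L ^ N).coeff i = 0)
    (j : ℤ) :
    (L ^ N * P).coeff j = ∑ s ∈ range (N + 1), ∑ μ ∈ range (N - s + 1),
      ((s + μ).choose s • (L ^ N).coeff ((s + μ : ℕ) : ℤ)) * δ^[μ] (P.coeff (j - s)) := by
  obtain ⟨M', hM, hM'⟩ : ∃ M' : ℤ, M ≤ M' ∧ j ≤ M' ∧ 0 ≤ M' :=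
    ⟨max M (max j 0), by simp⟩
  have hP' : ∀ i, M' < i → P.coeff i = 0 := fun i hi => hP i (by omega)
  rw [coeff_mul_eq_sum (L ^ N) P (c := -N + j - M') hN hP' (by omega) (by omega), sum_comm,
    sum_Icc_eq_sum_range_sub j (N + 1)]
  · refine sum_congr rfl fun s hs => ?_
    rw [mem_range] at hs
    rw [sum_Icc_eq_sum_range s (N - s + 1)]
    · refine sum_congr rfl fun μ _ => ?_
      rw [monoMul_of_eq μ (by omega), ← Nat.cast_add, Ring.choose_natCast, Nat.choose_symm_add,
        smul_mul_assoc, natCast_zsmul]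
    · intro i h
      refine ⟨?_, ?_⟩
      · by_contra hcon
        exact h (monoMul_of_lt (by omega))
      · by_contra hcon
        rw [hN i (by omega), monoMul_zero_left] at h
        exact h rfl
    · intro k hk _
      omega
  · intro l hl hl' h
    by_contra hcon
    refine h (sum_eq_zero fun i hi => ?_)
    rw [mem_Icc] at hi
    by_cases hij : i + l < j
    · exact monoMul_of_lt hij
    -- For `i ≥ 0`, reaching order `j < l` would take more than `i` derivatives, so only orders `l ≤
    -- j` of `P` enter.
    · by_cases hi0 : i < 0
      · rw [hN' i hi0, monoMul_zero_left]
      · rw [monoMul, if_pos (by omega), choose_natCast_eq_zero (by omega) (by omega), zero_smul]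
  · intro k hk _
    omega

theorem coeff_sub (P Q : PsiDO δ) (j : ℤ) : (P - Q).coeff j = P.coeff j - Q.coeff j := rfl

/-- The commutator `[P_+, L]` in terms of the coefficients of `P_-`, when `P` commutes with `L`. -/
theorem coeff_nonnegPart_comm {L P : PsiDO δ} {M : ℤ} (hP : ∀ i, M < i → P.coeff i = 0)
    (h1 : ∀ j, 1 < j → L.coeff j = 0) (h1' : L.coeff 1 = 1) (hPL : P * L = L * P) (a : ℕ) :
    (P.nonnegPart * L - L * P.nonnegPart).coeff (-((a : ℤ) + 1)) =
      ∑ b ∈ range (a + 1), ∑ i ∈ range (a + 2 - (b + 1) + 1),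
        (Ring.choose (1 - (i : ℤ)) (a + 2 - (b + 1) - i) • (L.coeff (1 - i) *
            δ^[a + 2 - (b + 1) - i] (P.coeff (-((b : ℤ) + 1))))
          - Ring.choose (-((b + 1 : ℕ) : ℤ)) (a + 2 - (b + 1) - i) • (P.coeff (-((b : ℤ) + 1)) *
            δ^[a + 2 - (b + 1) - i] (L.coeff (1 - i)))) := by
  obtain ⟨M', hM, hM'⟩ : ∃ M' : ℤ, M ≤ M' ∧ 0 ≤ M' := ⟨max M 0, by simp⟩
  have hP' : ∀ i, M' < i → P.coeff i = 0 := fun i hi => hP i (by omega)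
  have hP'' : ∀ i, M' < i → P.nonnegPart.coeff i = 0 := fun i hi => by
    change (if 0 ≤ i then P.coeff i else 0) = 0
    rw [hP' i hi, ite_self]
  set j : ℤ := -((a : ℤ) + 1) with hj
  obtain ⟨c, hc⟩ : ∃ c : ℤ, c = j - 1 - M' := ⟨_, rfl⟩
  have key : (P.nonnegPart * L - L * P.nonnegPart).coeff j =
      ∑ i ∈ Icc c M', ∑ l ∈ Icc c 1, (monoMul δ (L.coeff l) l (if 0 ≤ i then 0 else P.coeff i) i j -
        monoMul δ (if 0 ≤ i then 0 else P.coeff i) i (L.coeff l) l j) := by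
    -- Since `P` commutes with `L`, `[P_+, L] = [L, P_-]`.
    trans ((L * P).coeff j - (L * P.nonnegPart).coeff j) -
      ((P * L).coeff j - (P.nonnegPart * L).coeff j)
    · rw [hPL, coeff_sub]; ring
    rw [coeff_mul_eq_sum L P (c := c) h1 hP' (by omega) (by omega),
      coeff_mul_eq_sum P L (c := c) hP' h1 (by omega) (by omega),
      coeff_mul_eq_sum L P.nonnegPart (c := c) h1 hP'' (by omega) (by omega),
      coeff_mul_eq_sum P.nonnegPart L (c := c) hP'' h1 (by omega) (by omega),
      sum_comm (s := Icc c 1), sum_comm (s := Icc c 1)]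
    simp_rw [sum_sub_distrib]
    simp_rw [← sum_sub_distrib]
    refine sum_congr rfl fun i _ => sum_congr rfl fun l _ => ?_
    change monoMul δ _ _ _ _ _ - monoMul δ _ _ (if 0 ≤ i then P.coeff i else 0) _ _ -
      (_ - monoMul δ (if 0 ≤ i then P.coeff i else 0) _ _ _ _) = _
    split_ifs <;> simp
  rw [key, sum_Icc_eq_sum_range_sub (-1) (a + 1)]
  · refine sum_congr rfl fun b hb => ?_
    rw [mem_range] at hb
    rw [sum_Icc_eq_sum_range_sub 1 (a + 2 - (b + 1) + 1)]
    · refine sum_congr rfl fun i hi => ?_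
      rw [mem_range] at hi
      rw [if_neg (by omega), show (-1 - b : ℤ) = -(b + 1) by ring,
        monoMul_of_eq (a + 2 - (b + 1) - i) (by omega),
        monoMul_of_eq (a + 2 - (b + 1) - i) (by omega), Nat.cast_succ]
    · intro l hl hl' h
      refine ⟨hl', ?_⟩
      by_contra hcon
      refine h ?_
      rw [monoMul_of_lt (by omega), monoMul_of_lt (by omega), sub_zero]
    · intro k hk _
      omega
  · intro i hi hi' h
    by_contra hcon
    refine h (sum_eq_zero fun l hl => ?_)
    rw [mem_Icc] at hl
    by_cases hi0 : 0 ≤ i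
    · simp [hi0]
    by_cases hl1 : i + l < j
    · rw [monoMul_of_lt (by omega), monoMul_of_lt hl1, sub_zero]
    -- The only term that could bring in the coefficient of order `j - 1` comes from the leading `∂`
    -- of `L`, and it cancels in the commutator.
    · obtain rfl : l = 1 := by omega
      rw [monoMul_of_eq 0 (by omega), monoMul_of_eq 0 (by omega), h1']
      simp
  · intro k hk _
    omega

/-! ### The adjoint constraint and the coefficients of the operators `B` -/

/-- Splits off the first block. Working with lists of blocks avoids transport between the types of
compositions of different numbers. -/
theorem sum_composition_succ {M : Type*} [AddCommMonoid M] (s : ℕ) (F : List ℕ → M) :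
    ∑ c : Composition (s + 1), F c.blocks =
      ∑ i ∈ range (s + 1), ∑ c : Composition (s - i), F ((i + 1) :: c.blocks) := by
  rw [sum_sigma']
  symm
  refine sum_bij (fun x hx => (⟨(x.1 + 1) :: x.2.blocks, ?_, ?_⟩ : Composition (s + 1))) ?_ ?_ ?_ ?_
  · intro i hi
    rcases List.mem_cons.1 hi with rfl | h
    · omega
    · exact x.2.blocks_pos h
  · have : x.1 < s + 1 := by simpa using hx
    rw [List.sum_cons, x.2.blocks_sum]
    omega
  · intros; exact mem_univ _
  · rintro ⟨i, c⟩ _ ⟨i', c'⟩ _ h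
    have h' := congrArg Composition.blocks h
    simp only [List.cons.injEq, Nat.add_right_cancel_iff] at h'
    obtain ⟨rfl, h2⟩ := h'
    rw [Composition.ext h2]
  · intro c _
    have hs := c.blocks_sum
    match hb : c.blocks with
    | [] => rw [hb] at hs; simp at hs
    | b :: t =>
      have hpos : 0 < b := c.blocks_pos (by rw [hb]; exact List.mem_cons_self)
      rw [hb, List.sum_cons] at hs
      refine ⟨⟨b - 1, ⟨t, fun hi => c.blocks_pos (by rw [hb]; exact List.mem_cons_of_mem _ hi),
        by omega⟩⟩, by simp only [mem_sigma, mem_range, mem_univ, and_true]; omega, ?_⟩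
      apply Composition.ext
      simp only [hb, Nat.sub_add_cancel hpos]
  · intros; rfl

/-- `∏_γ C(a - 2 (b_1 + ⋯ + b_{γ-1}), 2 b_γ)` for a list `b_1, b_2, …`. -/
def blockProd : ℕ → List ℕ → ℚ
  | _, [] => 1
  | a, b :: t => (a.choose (2 * b) : ℚ) * blockProd (a - 2 * b) t

theorem prod_eq_blockProd (a : ℕ) (t : List ℕ) :
    ∏ γ : Fin t.length, ((a - 2 * (t.take γ).sum).choose (2 * t.get γ) : ℚ) = blockProd a t := by
  induction t generalizing a with
  | nil => rfl
  | cons b t ih =>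
    rw [blockProd, ← ih]
    refine (Fin.prod_univ_succ (n := t.length) _).trans ?_
    congr 1
    refine prod_congr rfl fun γ _ => ?_
    congr 2
    simp only [Fin.val_succ, List.take_succ_cons, List.sum_cons]
    omega

theorem bCoeff_eq (k l μ : ℕ) : bCoeff k l μ =
    ∑ s ∈ range (l - μ + 1), ∑ c : Composition s, (-1 / 2 : ℚ) ^ (c.blocks.length + 1)
      * blockProd (2 * l - 1 + k) c.blocks
      * ((2 * l - 1 + k - 2 * s).choose (2 * l - 2 * μ + 1 - 2 * s) : ℚ) := by
  refine sum_congr rfl fun s _ => sum_congr rfl fun c _ => ?_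
  rw [← prod_eq_blockProd]
  rfl

/-- The empty sequence gives the first term; otherwise the sum is grouped by the first index `i_1 =
2(i+1)`, and what follows is the same sum with `l` lowered by `i + 1`. This is the recursion
obtained by solving the adjoint constraint for `u_(2l+1)`. -/
theorem bCoeff_rec (k : ℕ) {l μ : ℕ} (hμ : 1 ≤ μ) (hl : μ ≤ l) : bCoeff k l μ =
    -1 / 2 * ((2 * l - 1 + k).choose (2 * l - 2 * μ + 1) : ℚ) +
    ∑ i ∈ range (l - μ), -1 / 2 * ((2 * l - 1 + k).choose (2 * (i + 1)) : ℚ) *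
      bCoeff k (l - (i + 1)) μ := by
  rw [bCoeff_eq, sum_range_succ', add_comm]
  congr 1
  · rw [Fintype.sum_eq_single (Composition.ones 0) fun c hc => absurd
      (Composition.ext (by rw [c.blocks_eq_nil.2 rfl, (Composition.ones 0).blocks_eq_nil.2 rfl])) hc]
    simp [blockProd]
  · obtain ⟨f, hf⟩ : ∃ f : ℕ → ℕ → ℚ, f = fun i s' => ∑ c : Composition s',
        -1 / 2 * ((2 * l - 1 + k).choose (2 * (i + 1)) : ℚ) *
        ((-1 / 2 : ℚ) ^ (c.blocks.length + 1) * blockProd (2 * (l - (i + 1)) - 1 + k) c.blocks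
        * ((2 * (l - (i + 1)) - 1 + k - 2 * s').choose
          (2 * (l - (i + 1)) - 2 * μ + 1 - 2 * s') : ℚ)) := ⟨_, rfl⟩
    have h1 : ∀ s ∈ range (l - μ), (∑ c : Composition (s + 1),
        (-1 / 2 : ℚ) ^ (c.blocks.length + 1) * blockProd (2 * l - 1 + k) c.blocks
          * ((2 * l - 1 + k - 2 * (s + 1)).choose (2 * l - 2 * μ + 1 - 2 * (s + 1)) : ℚ)) =
        ∑ i ∈ range (s + 1), f i (s - i) := by
      intro s hs
      rw [sum_composition_succ s fun b => (-1 / 2 : ℚ) ^ (b.length + 1) *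
        blockProd (2 * l - 1 + k) b *
          ((2 * l - 1 + k - 2 * (s + 1)).choose (2 * l - 2 * μ + 1 - 2 * (s + 1)) : ℚ), hf]
      refine sum_congr rfl fun i hi => sum_congr rfl fun c _ => ?_
      rw [mem_range] at hs hi
      rw [blockProd, List.length_cons,
        show 2 * l - 1 + k - 2 * (i + 1) = 2 * (l - (i + 1)) - 1 + k by omega,
        show 2 * (l - (i + 1)) - 1 + k - 2 * (s - i) = 2 * l - 1 + k - 2 * (s + 1) by omega,
        show 2 * (l - (i + 1)) - 2 * μ + 1 - 2 * (s - i) = 2 * l - 2 * μ + 1 - 2 * (s + 1) by omega]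
      ring
    rw [sum_congr rfl h1, sum_range_diag_flip, hf]
    refine sum_congr rfl fun i hi => ?_
    rw [mem_range] at hi
    rw [bCoeff_eq, mul_sum, show l - (i + 1) - μ + 1 = l - μ - i by omega]
    exact sum_congr rfl fun s _ => (mul_sum _ _ _).symm

theorem adjoint_coeff_eq_sum {L : PsiDO δ} (h1 : ∀ j, 1 < j → L.coeff j = 0) {i : ℤ} {K : ℕ}
    (hK : 2 ≤ i + K) : L.adjoint.coeff i = ∑ k ∈ range K,
      ((Int.negOnePow (i + k) : ℤ) * Ring.choose (i + k) k) • δ^[k] (L.coeff (i + k)) := by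
  refine finsum_eq_sum_of_support_subset _ fun k hk => ?_
  rw [Function.mem_support] at hk
  rw [mem_coe, mem_range]
  by_contra h
  rw [h1 _ (by omega), iterate_map_zero, smul_zero] at hk
  exact hk rfl

/-- For `k = 1` this is the constraint multiplied by `∂⁻¹` from the left. Writing `F_i` for the
left-hand side, Pascal's rule turns the coefficient of `∂^i` in the constraint into `F_i + δ F_(i+1)
= 0`. As `F_i = 0` for `i ≥ 2`, descending induction on `i` gives `F_i = 0` for all `i`. -/
theorem adjoint_relation {L : PsiDO δ} (h1 : ∀ j, 1 < j → L.coeff j = 0) {k : ℕ}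
    (hk : k = 0 ∨ k = 1)
    (hadj : L.adjoint = -(PsiDO.dpow δ k * L * PsiDO.dpow δ (-k))) {i : ℤ} {K : ℕ}
    (hK : 2 ≤ i + K) : ∑ j ∈ range K, ((Int.negOnePow (i + j) : ℤ) * Ring.choose (i - k + j) j) •
      δ^[j] (L.coeff (i + j)) + L.coeff i = 0 := by
  have hc : ∀ i, L.adjoint.coeff i = -(PsiDO.dpow δ k * L * PsiDO.dpow δ (-k)).coeff i := by
    intro i; rw [hadj]; rfl
  rcases hk with rfl | rfl
  · have := hc i
    rw [adjoint_coeff_eq_sum h1 hK, PsiDO.coeff_mul_dpow, Nat.cast_zero, neg_zero, sub_zero,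
      show PsiDO.dpow δ 0 * L = L from L.one_mul] at this
    rw [Nat.cast_zero, sub_zero, this, neg_add_cancel]
  · have hc' : ∀ i, L.adjoint.coeff i = -(L.coeff i + δ (L.coeff (i + 1))) := by
      intro i
      rw [hc, PsiDO.coeff_mul_dpow, Nat.cast_one, PsiDO.coeff_dpow_one_mul]
      congr 3
      all_goals ring_nf
    obtain ⟨n, hn⟩ : ∃ n : ℕ, 2 ≤ i + n := ⟨(2 - i).toNat, by omega⟩
    induction n generalizing i K with
    | zero =>
      rw [h1 i (by omega), add_zero]
      refine sum_eq_zero fun j _ => ?_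
      rw [h1 _ (by omega), iterate_map_zero, smul_zero]
    | succ n ih =>
      by_cases hi : 2 ≤ i
      · rw [h1 i (by omega), add_zero]
        refine sum_eq_zero fun j _ => ?_
        rw [h1 _ (by omega), iterate_map_zero, smul_zero]
      obtain ⟨K, rfl⟩ : ∃ K', K = K' + 1 := ⟨K - 1, by omega⟩
      have e1 := hc' i
      rw [adjoint_coeff_eq_sum h1 hK, sum_range_succ'] at e1
      have e2 := congrArg δ (ih (i := i + 1) (K := K) (by push_cast at hK; omega)
        (by push_cast at hn; omega))
      rw [map_add, map_sum, map_zero] at e2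
      rw [sum_range_succ']
      have e3 : ∑ x ∈ range K, ((Int.negOnePow (i + ↑(x + 1)) : ℤ) *
          Ring.choose (i + ↑(x + 1)) (x + 1)) • δ^[x + 1] (L.coeff (i + ↑(x + 1))) =
          ∑ x ∈ range K, ((Int.negOnePow (i + ↑(x + 1)) : ℤ) *
            Ring.choose (i - (1 : ℕ) + ↑(x + 1)) (x + 1)) • δ^[x + 1] (L.coeff (i + ↑(x + 1))) +
          ∑ x ∈ range K, δ (((Int.negOnePow (i + 1 + x) : ℤ) *
            Ring.choose (i + 1 - (1 : ℕ) + x) x) • δ^[x] (L.coeff (i + 1 + x))) := by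
        rw [← sum_add_distrib]
        refine sum_congr rfl fun x _ => ?_
        rw [map_zsmul, ← Function.iterate_succ_apply' (⇑δ), ← show i + (x + 1 : ℕ) = i + 1 + x by
          push_cast; ring, ← add_smul, ← mul_add]
        congr 2
        rw [show i + ((x + 1 : ℕ) : ℤ) = i + x + 1 by push_cast; ring, Ring.choose_succ_succ,
          show i + 1 - ((1 : ℕ) : ℤ) + x = i + x by push_cast; ring,
          show i - ((1 : ℕ) : ℤ) + ((x + 1 : ℕ) : ℤ) = i + x by push_cast; ring, add_comm]
      rw [e3] at e1
      simp only [Ring.choose_zero_right] at e1 ⊢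
      linear_combination e1 - e2

theorem sum_range_two_mul {M : Type*} [AddCommMonoid M] (f : ℕ → M) (n : ℕ) :
    ∑ k ∈ range (2 * n), f k = ∑ j ∈ range n, f (2 * j) + ∑ j ∈ range n, f (2 * j + 1) := by
  induction n with
  | zero => simp
  | succ n ih =>
    rw [Nat.mul_succ, sum_range_succ, sum_range_succ, ih, sum_range_succ, sum_range_succ]
    abel

/-- At an even order the term without derivatives has sign `+`, so the coefficient itself appears
twice and can be solved for. Negating the upper index makes all the binomials those of `2l + 1 + k`,
without signs; the terms from `u_0 = 1` and `u_1 = 0` drop out. -/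
theorem coeff_even_relation {L : PsiDO δ} (h1 : ∀ j, 1 < j → L.coeff j = 0)
    (h1' : L.coeff 1 = 1) (h0 : L.coeff 0 = 0) {k : ℕ} (hk : k = 0 ∨ k = 1)
    (hadj : L.adjoint = -(PsiDO.dpow δ k * L * PsiDO.dpow δ (-k))) (l : ℕ) :
    2 * L.coeff (-(2 * (l + 1 : ℕ))) +
      ∑ j ∈ range (l + 1), ((2 * l + 1 + k).choose (2 * j + 1) : ℚ) •
        δ^[2 * j + 1] (L.coeff (1 - 2 * (l + 1 - j : ℕ))) +
      ∑ j ∈ range l, ((2 * l + 1 + k).choose (2 * (j + 1)) : ℚ) •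
        δ^[2 * (j + 1)] (L.coeff (-(2 * (l - j : ℕ)))) = 0 := by
  have h := adjoint_relation h1 hk hadj (i := -(2 * (l + 1 : ℕ))) (K := 2 * (l + 2))
    (by push_cast; omega)
  have e : ∀ j : ℕ, ((Int.negOnePow (-(2 * (l + 1 : ℕ)) + j) : ℤ) *
      Ring.choose (-(2 * (l + 1 : ℕ) : ℤ) - k + j) j) = ((2 * l + 1 + k).choose j : ℤ) := by
    intro j
    rw [show (-(2 * (l + 1 : ℕ) : ℤ) - k + j) = -(2 * (l + 1 : ℕ) + k - j) by ring,
      Ring.choose_neg, show (2 * (l + 1 : ℕ) + k - j : ℤ) + j - 1 = (2 * l + 1 + k : ℕ) by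
        push_cast; ring, Ring.choose_natCast, Int.negOnePow_add, Int.negOnePow_even _ ⟨-(l + 1 : ℕ),
        by push_cast; ring⟩, one_mul]
    rw [Units.smul_def, smul_eq_mul, ← mul_assoc, ← Units.val_mul, ← Int.negOnePow_add,
      Int.negOnePow_even _ ⟨j, rfl⟩, Units.val_one, one_mul]
  simp only [e] at h
  have z1 : δ^[2 * (l + 1) + 1] (L.coeff (-(2 * (l + 1 : ℕ)) + (2 * (l + 1) + 1 : ℕ))) = 0 := by
    rw [show (-(2 * (l + 1 : ℕ)) + (2 * (l + 1) + 1 : ℕ) : ℤ) = 1 by push_cast; ring, h1',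
      Function.iterate_succ_apply, Derivation.map_one_eq_zero, iterate_map_zero]
  have z0 : δ^[2 * (l + 1)] (L.coeff (-(2 * (l + 1 : ℕ)) + (2 * (l + 1) : ℕ))) = 0 := by
    rw [show (-(2 * (l + 1 : ℕ)) + (2 * (l + 1) : ℕ) : ℤ) = 0 by push_cast; ring, h0,
      iterate_map_zero]
  rw [sum_range_two_mul, sum_range_succ', sum_range_succ (n := l + 1), sum_range_succ (n := l),
    z1, z0, smul_zero, smul_zero, add_zero, add_zero] at h
  have f1 : ∀ j ∈ range (l + 1), ((2 * l + 1 + k).choose (2 * j + 1) : ℤ) •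
      δ^[2 * j + 1] (L.coeff (-(2 * (l + 1 : ℕ)) + (2 * j + 1 : ℕ))) =
      ((2 * l + 1 + k).choose (2 * j + 1) : ℚ) •
        δ^[2 * j + 1] (L.coeff (1 - 2 * (l + 1 - j : ℕ))) := by
    intro j hj
    rw [mem_range] at hj
    rw [natCast_zsmul, Nat.cast_smul_eq_nsmul,
      show (-(2 * (l + 1 : ℕ)) + (2 * j + 1 : ℕ) : ℤ) = 1 - 2 * (l + 1 - j : ℕ) by omega]
  have f2 : ∀ j ∈ range l, ((2 * l + 1 + k).choose (2 * (j + 1)) : ℤ) •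
      δ^[2 * (j + 1)] (L.coeff (-(2 * (l + 1 : ℕ)) + (2 * (j + 1) : ℕ))) =
      ((2 * l + 1 + k).choose (2 * (j + 1)) : ℚ) •
        δ^[2 * (j + 1)] (L.coeff (-(2 * (l - j : ℕ)))) := by
    intro j hj
    rw [mem_range] at hj
    rw [natCast_zsmul, Nat.cast_smul_eq_nsmul,
      show (-(2 * (l + 1 : ℕ)) + (2 * (j + 1) : ℕ) : ℤ) = -(2 * (l - j : ℕ)) by omega]
  rw [sum_congr rfl f1, sum_congr rfl f2] at h
  simp only [mul_zero, Nat.choose_zero_right, Nat.cast_one, one_smul, Nat.cast_zero, add_zero,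
    Function.iterate_zero, id] at h
  linear_combination h

theorem iterate_map_smul (n : ℕ) (q : ℚ) (f : A) : δ^[n] (q • f) = q • δ^[n] f := by
  induction n with
  | zero => rfl
  | succ n ih => rw [Function.iterate_succ_apply', ih, Derivation.map_smul, Function.iterate_succ_apply']

/-- The even coefficients of `L` in terms of the odd ones. -/
theorem coeff_even_eq {L : PsiDO δ} (h1 : ∀ j, 1 < j → L.coeff j = 0)
    (h1' : L.coeff 1 = 1) (h0 : L.coeff 0 = 0) {k : ℕ} (hk : k = 0 ∨ k = 1)
    (hadj : L.adjoint = -(PsiDO.dpow δ k * L * PsiDO.dpow δ (-k))) (l : ℕ) :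
    L.coeff (-(2 * (l : ℤ))) = ∑ μ ∈ range l, bCoeff k l (μ + 1) •
      δ^[2 * l - 2 * (μ + 1) + 1] (L.coeff (1 - 2 * (μ + 1 : ℕ))) := by
  induction l using Nat.strong_induction_on with
  | _ l ih =>
  obtain _ | l := l
  · simpa using h0
  have h := coeff_even_relation h1 h1' h0 hk hadj l
  have e1 : ∀ j ∈ range l, ((2 * l + 1 + k).choose (2 * (j + 1)) : ℚ) •
        δ^[2 * (j + 1)] (L.coeff (-(2 * (l - j : ℕ)))) =
      ∑ μ ∈ range (l - j), (((2 * l + 1 + k).choose (2 * (j + 1)) : ℚ) * bCoeff k (l - j) (μ + 1)) •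
        δ^[2 * (l + 1) - 2 * (μ + 1) + 1] (L.coeff (1 - 2 * (μ + 1 : ℕ))) := by
    intro j hj
    rw [mem_range] at hj
    rw [ih (l - j) (by omega), iterate_map_finset_sum, smul_sum]
    refine sum_congr rfl fun μ hμ => ?_
    rw [mem_range] at hμ
    rw [iterate_map_smul, smul_smul, ← Function.iterate_add_apply,
      show 2 * (j + 1) + (2 * (l - j) - 2 * (μ + 1) + 1) = 2 * (l + 1) - 2 * (μ + 1) + 1 by omega]
  have e2 : ∑ j ∈ range (l + 1), ((2 * l + 1 + k).choose (2 * j + 1) : ℚ) •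
        δ^[2 * j + 1] (L.coeff (1 - 2 * (l + 1 - j : ℕ))) =
      ∑ μ ∈ range (l + 1), ((2 * l + 1 + k).choose (2 * (l + 1) - 2 * (μ + 1) + 1) : ℚ) •
        δ^[2 * (l + 1) - 2 * (μ + 1) + 1] (L.coeff (1 - 2 * (μ + 1 : ℕ))) := by
    rw [← sum_range_reflect]
    refine sum_congr rfl fun μ hμ => ?_
    rw [mem_range] at hμ
    rw [show 2 * (l + 1 - 1 - μ) + 1 = 2 * (l + 1) - 2 * (μ + 1) + 1 by omega,
      show l + 1 - (l + 1 - 1 - μ) = μ + 1 by omega]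
  have e3 : ∑ j ∈ range l, ∑ μ ∈ range (l - j),
      (((2 * l + 1 + k).choose (2 * (j + 1)) : ℚ) * bCoeff k (l - j) (μ + 1)) •
        δ^[2 * (l + 1) - 2 * (μ + 1) + 1] (L.coeff (1 - 2 * (μ + 1 : ℕ))) =
      ∑ μ ∈ range (l + 1), ∑ j ∈ range (l - μ),
      (((2 * l + 1 + k).choose (2 * (j + 1)) : ℚ) * bCoeff k (l - j) (μ + 1)) •
        δ^[2 * (l + 1) - 2 * (μ + 1) + 1] (L.coeff (1 - 2 * (μ + 1 : ℕ))) := by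
    refine sum_comm' fun j μ => ?_
    simp only [mem_range]
    omega
  rw [sum_congr rfl e1, e2, e3] at h
  -- Dividing the relation by `2` produces the factor `-1/2` of `bCoeff_rec`.
  have e4 : ∑ μ ∈ range (l + 1), bCoeff k (l + 1) (μ + 1) •
      δ^[2 * (l + 1) - 2 * (μ + 1) + 1] (L.coeff (1 - 2 * (μ + 1 : ℕ))) = (-1 / 2 : ℚ) •
      (∑ μ ∈ range (l + 1), ((2 * l + 1 + k).choose (2 * (l + 1) - 2 * (μ + 1) + 1) : ℚ) •
        δ^[2 * (l + 1) - 2 * (μ + 1) + 1] (L.coeff (1 - 2 * (μ + 1 : ℕ))) +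
      ∑ μ ∈ range (l + 1), ∑ j ∈ range (l - μ),
      (((2 * l + 1 + k).choose (2 * (j + 1)) : ℚ) * bCoeff k (l - j) (μ + 1)) •
        δ^[2 * (l + 1) - 2 * (μ + 1) + 1] (L.coeff (1 - 2 * (μ + 1 : ℕ)))) := by
    rw [← sum_add_distrib, smul_sum]
    refine sum_congr rfl fun μ hμ => ?_
    rw [mem_range] at hμ
    rw [bCoeff_rec k (by omega) (by omega), ← sum_smul, ← add_smul, smul_smul, mul_add (-1 / 2 : ℚ), mul_sum,
      show 2 * (l + 1) - 1 + k = 2 * l + 1 + k by omega,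
      show l + 1 - (μ + 1) = l - μ by omega]
    congr 2
    refine sum_congr rfl fun i hi => ?_
    rw [show l + 1 - (i + 1) = l - i by omega]
    ring
  have h2 : (2 : ℚ) • L.coeff (-(2 * (l + 1 : ℕ))) = 2 * L.coeff (-(2 * (l + 1 : ℕ))) := by
    rw [Algebra.smul_def, map_ofNat]
  rw [← h2, add_assoc] at h
  rw [e4, ← neg_eq_of_add_eq_zero_right h, smul_neg, smul_smul]
  norm_num

end BCKP

/-! ### Triangular matrices over a noncommutative ring -/

/-- The entries need not commute, so determinants are not available. Factoring out the diagonal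
leaves `1 + X` with `X` strictly lower triangular, hence nilpotent. -/
theorem Matrix.isUnit_of_lowerTriangular {R : Type*} [Ring R] {n : ℕ}
    (M : Matrix (Fin n) (Fin n) R) (h0 : ∀ a b, a < b → M a b = 0) (hd : ∀ a, IsUnit (M a a)) :
    IsUnit M := by
  choose d hd using hd
  obtain ⟨X, hX⟩ : ∃ X, X = Matrix.diagonal (fun a => ((d a)⁻¹ : Rˣ).val) * M - 1 := ⟨_, rfl⟩
  have hX0 : ∀ a b, a ≤ b → X a b = 0 := by
    intro a b hab
    rw [hX, Matrix.sub_apply, Matrix.diagonal_mul]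
    rcases hab.lt_or_eq with h | rfl
    · rw [h0 a b h, mul_zero, Matrix.one_apply_ne h.ne, sub_zero]
    · rw [← hd, Units.inv_mul, Matrix.one_apply_eq, sub_self]
  have hXk : ∀ (k : ℕ) (a b : Fin n), (a : ℕ) < b + k → (X ^ k) a b = 0 := by
    intro k
    induction k with
    | zero => intro a b h; rw [pow_zero, Matrix.one_apply_ne (by rintro rfl; omega)]
    | succ k ih =>
      intro a b h
      rw [pow_succ, Matrix.mul_apply]
      refine sum_eq_zero fun c _ => ?_
      by_cases hc : c ≤ b
      · rw [hX0 c b hc, mul_zero]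
      · rw [ih a c (by rw [not_le, Fin.lt_def] at hc; omega), zero_mul]
  have hnil : IsNilpotent X := ⟨n, by ext a b; exact hXk n a b (by omega)⟩
  have hD : IsUnit (Matrix.diagonal fun a => (d a).val) := by
    refine ⟨⟨Matrix.diagonal fun a => (d a).val, Matrix.diagonal fun a => ((d a)⁻¹ : Rˣ).val,
      ?_, ?_⟩, rfl⟩
    all_goals
      rw [Matrix.diagonal_mul_diagonal]
      simp
  have hM : M = Matrix.diagonal (fun a => (d a).val) * (1 + X) := by
    rw [hX, add_sub_cancel, ← Matrix.mul_assoc, Matrix.diagonal_mul_diagonal]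
    simp
  rw [hM]
  exact hD.mul hnil.isUnit_one_add

theorem AddMonoid.End.isUnit_of_bijective {V : Type*} [AddCommGroup V] {D : AddMonoid.End V}
    (hD : Function.Bijective D) : IsUnit D :=
  ⟨⟨D, (AddEquiv.ofBijective D hD).symm.toAddMonoidHom,
    by ext v; exact (AddEquiv.ofBijective D hD).apply_symm_apply v,
    by ext v; exact (AddEquiv.ofBijective D hD).symm_apply_apply v⟩, rfl⟩

theorem Fin.sum_univ_two_mul {M : Type*} [AddCommMonoid M] {n : ℕ} (f : Fin (2 * n) → M) :
    ∑ b, f b = ∑ a : Fin n, f ⟨2 * a, by omega⟩ + ∑ a : Fin n, f ⟨2 * a + 1, by omega⟩ := by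
  obtain ⟨g, hg⟩ : ∃ g : ℕ → M, ∀ b (hb : b < 2 * n), f ⟨b, hb⟩ = g b :=
    ⟨fun b => if h : b < 2 * n then f ⟨b, h⟩ else 0, fun b hb => by simp only [dif_pos hb]⟩
  simp only [hg]
  rw [Fin.sum_univ_eq_sum_range (fun a => g (2 * a)),
    Fin.sum_univ_eq_sum_range (fun a => g (2 * a + 1)), ← BCKP.sum_range_two_mul,
    ← Fin.sum_univ_eq_sum_range]

/-! ### Matrices of operators acting on vectors -/

namespace BCKP

variable {V : Type*} [AddCommGroup V]

/-- The action of a matrix of operators on a vector. -/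
def actVec {ι κ : Type*} [Fintype κ] (M : Matrix ι κ (AddMonoid.End V)) (x : κ → V) (a : ι) : V :=
  ∑ b, M a b (x b)

section actVec

variable {ι κ τ : Type*} [Fintype κ] [Fintype τ]

theorem actVec_mul (M : Matrix ι κ (AddMonoid.End V)) (N : Matrix κ τ (AddMonoid.End V))
    (x : τ → V) : actVec (M * N) x = actVec M (actVec N x) := by
  ext a
  simp only [actVec, Matrix.mul_apply, map_sum]
  rw [sum_comm]
  refine sum_congr rfl fun b _ => ?_
  induction (univ : Finset κ) using Finset.cons_induction with
  | empty => rfl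
  | cons c s hc ih => rw [sum_cons, sum_cons, ← ih]; rfl

theorem actVec_sub (M N : Matrix ι κ (AddMonoid.End V)) (x : κ → V) :
    actVec (M - N) x = actVec M x - actVec N x := by
  ext a
  exact sum_sub_distrib (fun b => M a b (x b)) (fun b => N a b (x b))

theorem actVec_neg (M : Matrix ι κ (AddMonoid.End V)) (x : κ → V) :
    actVec M (-x) = -actVec M x := by
  ext a
  simp [actVec]

theorem actVec_one [DecidableEq κ] (x : κ → V) : actVec (1 : Matrix κ κ (AddMonoid.End V)) x = x := by
  ext a
  rw [actVec, Fintype.sum_eq_single a]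
  · rw [Matrix.one_apply_eq]; rfl
  · intro b hb
    rw [Matrix.one_apply_ne hb.symm]; rfl

end actVec

section mulOp

variable {A : Type*} [CommRing A] [Module A V]

theorem mulOp_one : mulOp V (1 : A) = 1 := map_one _

theorem mulOp_zero : mulOp V (0 : A) = 0 := map_zero _

theorem mulOp_nsmul (n : ℕ) (a : A) : mulOp V (n • a) = n • mulOp V a := map_nsmul _ _ _

end mulOp

theorem end_sum_apply {ι : Type*} (s : Finset ι) (f : ι → AddMonoid.End V) (v : V) :
    (∑ i ∈ s, f i) v = ∑ i ∈ s, f i v := by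
  induction s using Finset.cons_induction with
  | empty => rfl
  | cons c s hc ih => rw [sum_cons, sum_cons, ← ih]; rfl

variable {A : Type*} [CommRing A] [Algebra ℚ A] {δ : Derivation ℚ A A} [Module A V]

/-! ### Elements of the ideal as elements of the module -/

namespace NonlocalModule

variable {I : Ideal A} (W : NonlocalModule δ I V)

/-- `f ∈ I` and its image in `V` is `v`. -/
def Rep (f : A) (v : V) : Prop := ∃ h : f ∈ I, W.ι ⟨f, h⟩ = v

variable {W}

/-- The way identities in `V` are obtained: both sides represent the same element of `A`.
Injectivity of `ι` plays no role. -/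
theorem Rep.unique {f : A} {v w : V} (hv : W.Rep f v) (hw : W.Rep f w) : v = w := by
  obtain ⟨h, rfl⟩ := hv
  obtain ⟨h', rfl⟩ := hw
  rfl

theorem Rep.mul (a : A) {f : A} {v : V} (hv : W.Rep f v) : W.Rep (a * f) (a • v) := by
  obtain ⟨h, rfl⟩ := hv
  exact ⟨I.mul_mem_left _ h, W.ι.map_smul a ⟨f, h⟩⟩

theorem Rep.sub {f g : A} {v w : V} (hv : W.Rep f v) (hw : W.Rep g w) : W.Rep (f - g) (v - w) := by
  obtain ⟨h, rfl⟩ := hv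
  obtain ⟨h', rfl⟩ := hw
  exact ⟨I.sub_mem h h', W.ι.map_sub ⟨f, h⟩ ⟨g, h'⟩⟩

theorem Rep.sum {ι : Type*} {s : Finset ι} {f : ι → A} {v : ι → V}
    (h : ∀ i ∈ s, W.Rep (f i) (v i)) : W.Rep (∑ i ∈ s, f i) (∑ i ∈ s, v i) := by
  induction s using Finset.cons_induction with
  | empty => exact ⟨I.zero_mem, W.ι.map_zero⟩
  | cons c s hc ih =>
    rw [sum_cons, sum_cons]
    obtain ⟨h1, e1⟩ := h c (mem_cons_self _ _)
    obtain ⟨h2, e2⟩ := ih fun i hi => h i (mem_cons_of_mem hi)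
    rw [← e1, ← e2]
    exact ⟨I.add_mem h1 h2, W.ι.map_add ⟨_, h1⟩ ⟨_, h2⟩⟩

theorem Rep.iterate (hδI : ∀ f ∈ I, δ f ∈ I) {f : A} {v : V} (hv : W.Rep f v) (k : ℕ) :
    W.Rep (δ^[k] f) ((W.D ^ k) v) := by
  induction k with
  | zero => exact hv
  | succ k ih =>
    rw [Function.iterate_succ_apply', pow_succ']
    obtain ⟨h, e⟩ := ih
    refine ⟨hδI _ h, ?_⟩
    rw [AddMonoid.End.coe_mul, Function.comp_apply, ← e]
    exact W.ι_deriv ⟨_, h⟩ ⟨_, hδI _ h⟩ rfl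

end NonlocalModule

/-! ### Entries and invertibility of the matrices `M` and `Q` -/

section Entries

variable {L : PsiDO δ} {D : AddMonoid.End V}

theorem cCoeff_of_lt {N : ℕ} {j μ : ℤ} (h : (N : ℤ) < μ) : cCoeff L N j μ = 0 := by
  rw [cCoeff, Icc_eq_empty (by omega), sum_empty]

theorem cCoeff_self {N : ℕ} {j : ℤ} (hN : (L ^ N).coeff N = 1) : cCoeff L N j N = 1 := by
  rw [cCoeff, max_eq_right (by omega), Icc_self, sum_singleton, sub_self, Int.toNat_zero,
    Ring.choose_zero_right, one_smul, pCoeff]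
  exact hN

theorem cTilde_self {N : ℕ} (hN : (L ^ N).coeff N = 1) : cTilde L D N N = 1 := by
  simp [cTilde, pCoeff, hN, mulOp_one]

theorem cCoeff_pred {r : ℕ} {j : ℤ} (hN : (L ^ (r + 1)).coeff (r + 1 : ℕ) = 1) :
    cCoeff L (r + 1) j r = pCoeff L r (r + 1) := by
  have : Icc (r : ℤ) (r + 1 : ℕ) = {(r : ℤ), ((r + 1 : ℕ) : ℤ)} := by
    ext x
    simp only [mem_Icc, mem_insert, mem_singleton]
    omega
  rw [cCoeff, max_eq_right (by omega), this, sum_pair (by omega), sub_self,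
    show (((r + 1 : ℕ) : ℤ) - r).toNat = 1 by omega]
  simp only [pCoeff, hN, Function.iterate_one, Derivation.map_one_eq_zero, smul_zero, add_zero]
  simp

theorem dOp_pred {r : ℕ} {j : ℤ} (hN : (L ^ (r + 1)).coeff (r + 1 : ℕ) = 1) :
    dOp L D (r + 1) j r = -((r + 1) • D) := by
  rw [dOp, cCoeff_pred hN, cTilde, show r + 1 - r + 1 = 2 by omega, sum_range_succ, sum_range_one,
    Nat.choose_succ_self_right, add_zero, Nat.choose_self, one_smul, pow_zero, mul_one, pow_one,
    pCoeff, pCoeff, hN, mulOp_nsmul, mulOp_one, smul_mul_assoc, one_mul]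
  abel

/-- The two `u_1` terms cancel, and `u_0 = 1` has zero derivative; only `u_0 ∂` survives. -/
theorem oOp_succ (h1 : L.coeff 1 = 1) (b : ℕ) : oOp L D (b + 2) (b + 1) = D := by
  rw [oOp, show b + 2 - (b + 1) + 1 = 2 by omega, sum_range_succ, sum_range_one,
    show b + 2 - (b + 1) - 0 = 1 by omega, show b + 2 - (b + 1) - 1 = 0 by omega]
  simp [h1, mulOp_one, mulOp_zero]

theorem isUnit_matQ (h1 : L.coeff 1 = 1) (hD : Function.Bijective D) (r : ℕ) :
    IsUnit (matQ L D r) := by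
  refine Matrix.isUnit_of_lowerTriangular _ (fun a b hab => if_neg (not_le.2 hab)) fun a => ?_
  rw [matQ, Matrix.of_apply, if_pos le_rfl, oOp_succ h1]
  exact AddMonoid.End.isUnit_of_bijective hD

theorem isUnit_matM (L : PsiDO δ) (hD : Function.Bijective D) (r : ℕ) :
    IsUnit (matM L D r) := by
  refine Matrix.isUnit_of_lowerTriangular _ (fun a b hab => ?_) fun a => ?_
  · rw [matM, Matrix.of_apply, if_neg hab.ne, if_neg hab.not_gt]
  · rw [matM, Matrix.of_apply, if_pos rfl, IsUnit.neg_iff]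
    -- The diagonal entry is `-(r+1)∂`; its integer factor is invertible because `A` is a
    -- `ℚ`-algebra.
    have h : IsUnit ((r + 1 : ℕ) : A) := by
      rw [← map_natCast (algebraMap ℚ A)]
      exact (IsUnit.mk0 _ (by positivity)).map _
    have h2 : (r + 1) • D = mulOp V ((r + 1 : ℕ) : A) * D := by
      rw [← nsmul_one, mulOp_nsmul, mulOp_one, smul_mul_assoc, one_mul]
    rw [h2]
    exact (h.map (Module.toAddMonoidEnd A V)).mul (AddMonoid.End.isUnit_of_bijective hD)

/-- The operator through which the `b`-th coefficient enters the `a`-th coefficient of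
`P L^N - L^N P`. -/
noncomputable def commOp (L : PsiDO δ) (D : AddMonoid.End V) (N a b : ℕ) : AddMonoid.End V :=
  mulOp V (cCoeff L N (-((a : ℤ) + 1)) ((b : ℤ) - a)) -
    if a ≤ b ∧ b ≤ a + N then cTilde L D N (b - a) else 0

theorem commOp_eq_matN {r : ℕ} (a : Fin (r + 1)) (b : Fin r) :
    commOp L D (r + 1) a b = matN L D r a b := by
  rw [commOp, matN, Matrix.of_apply]
  by_cases h : (a : ℕ) ≤ b
  · rw [if_pos ⟨h, by omega⟩, if_pos h, dOp, Nat.cast_sub h]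
  · rw [if_neg (fun h' => h h'.1), if_neg h, sub_zero]

/-- The system is triangular because the leading coefficient `1` of `L^N` cancels above the
diagonal. On the diagonal the two copies of `p_(N-1)(N)` cancel as well, leaving `-N∂`. -/
theorem commOp_add {r : ℕ} (hN : (L ^ (r + 1)).coeff (r + 1 : ℕ) = 1) {a b : ℕ} (ha : a ≤ r) :
    commOp L D (r + 1) a (r + b) = if a = b then -((r + 1) • D) else
      if b < a then dOp L D (r + 1) (-((a : ℤ) + 1)) (r + b - a) else 0 := by
  by_cases h : b ≤ a
  · rw [commOp, if_pos ⟨by omega, by omega⟩, ← Nat.cast_sub (by omega)]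
    change dOp L D (r + 1) (-((a : ℤ) + 1)) (r + b - a) = _
    split_ifs with h1 h2
    · rw [h1, Nat.add_sub_cancel, dOp_pred hN]
    · rfl
    · omega
  rw [if_neg (by omega), if_neg (by omega), commOp]
  by_cases hb : b = a + 1
  · rw [if_pos (by omega), show ((r + b : ℕ) : ℤ) - a = (r + 1 : ℕ) by omega,
      show r + b - a = r + 1 by omega, cCoeff_self hN, cTilde_self hN, mulOp_one, sub_self]
  · rw [if_neg (by omega), cCoeff_of_lt (by omega), mulOp_zero, sub_zero]

end Entries

/-! ### Recursion from `L^m` to `L^(m+N)` -/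

section Flows

variable {I : Ideal A} {W : NonlocalModule δ I V} {L : PsiDO δ} {x : ℕ → ℕ → V}

theorem coeff_pow_add_right (h1 : ∀ j, 1 < j → L.coeff j = 0)
    (hx : ∀ m b : ℕ, W.Rep ((L ^ m).coeff (-((b : ℤ) + 1))) (x m b)) {N : ℕ}
    (hred : ∀ i : ℤ, i < 0 → (L ^ N).coeff i = 0) (m : ℕ) {a : ℕ} (ha : a < N) :
    x (m + N) a = ∑ b ∈ range (2 * N),
      mulOp V (cCoeff L N (-((a : ℤ) + 1)) ((b : ℤ) - a)) (x m b) := by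
  refine (hx (m + N) a).unique ?_
  rw [PsiDO.pow_add, coeff_mul_pow_eq_sum (M := m) (fun i hi => coeff_pow_eq_zero h1 m hi)
    (fun i hi => coeff_pow_eq_zero h1 N hi) hred ha]
  exact NonlocalModule.Rep.sum fun b _ => (hx m b).mul _

theorem coeff_pow_add_left (hδI : ∀ f ∈ I, δ f ∈ I) (h1 : ∀ j, 1 < j → L.coeff j = 0)
    (hx : ∀ m b : ℕ, W.Rep ((L ^ m).coeff (-((b : ℤ) + 1))) (x m b)) {N : ℕ}
    (hred : ∀ i : ℤ, i < 0 → (L ^ N).coeff i = 0) (m a : ℕ) :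
    x (m + N) a = ∑ s ∈ range (N + 1), cTilde L W.D N s (x m (a + s)) := by
  refine (hx (m + N) a).unique ?_
  rw [Nat.add_comm, PsiDO.pow_add, coeff_pow_mul_eq_sum (M := m)
    (fun i hi => coeff_pow_eq_zero h1 m hi) (fun i hi => coeff_pow_eq_zero h1 N hi) hred]
  refine NonlocalModule.Rep.sum fun s _ => ?_
  rw [cTilde, end_sum_apply]
  refine NonlocalModule.Rep.sum fun μ _ => ?_
  refine NonlocalModule.Rep.mul _ (NonlocalModule.Rep.iterate hδI ?_ μ)
  rw [show -((a : ℤ) + 1) - s = -((a + s : ℕ) + 1) by push_cast; ring]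
  exact hx m (a + s)

/-- Both `L^m L^N` and `L^N L^m` equal `L^(m+N)`; this is the difference of the two expressions for
its coefficient. -/
theorem sum_commOp (hδI : ∀ f ∈ I, δ f ∈ I) (h1 : ∀ j, 1 < j → L.coeff j = 0)
    (hx : ∀ m b : ℕ, W.Rep ((L ^ m).coeff (-((b : ℤ) + 1))) (x m b)) {N : ℕ}
    (hred : ∀ i : ℤ, i < 0 → (L ^ N).coeff i = 0) (m : ℕ) {a : ℕ} (ha : a < N) :
    ∑ b ∈ range (2 * N), commOp L W.D N a b (x m b) = 0 := by
  have e : ∑ b ∈ range (2 * N), (if a ≤ b ∧ b ≤ a + N then cTilde L W.D N (b - a) else 0) (x m b) =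
      ∑ s ∈ range (N + 1), cTilde L W.D N s (x m (a + s)) := by
    have : ∀ b, (if a ≤ b ∧ b ≤ a + N then cTilde L W.D N (b - a) else 0) (x m b) =
        if a ≤ b ∧ b ≤ a + N then cTilde L W.D N (b - a) (x m b) else 0 := by
      intro b
      split_ifs <;> rfl
    simp only [this]
    rw [← sum_filter, show (range (2 * N)).filter (fun b => a ≤ b ∧ b ≤ a + N) =
      Ico a (a + (N + 1)) by ext b; simp only [mem_filter, mem_range, mem_Ico]; omega,
      sum_Ico_eq_sum_range, Nat.add_sub_cancel_left]
    exact sum_congr rfl fun s _ => by rw [Nat.add_sub_cancel_left]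
  rw [← sub_self (x (m + N) a)]
  nth_rw 1 [coeff_pow_add_right h1 hx hred m ha]
  rw [coeff_pow_add_left hδI h1 hx hred m a, ← e, ← sum_sub_distrib]
  rfl

/-- Elimination of the coefficients of depth `N, …, 2N-1`: `hS` expresses the new vector through `x`
and these, and `hM` is a square system solving for them in terms of `x`. -/
theorem actVec_matR (hδI : ∀ f ∈ I, δ f ∈ I) (h1 : ∀ j, 1 < j → L.coeff j = 0)
    (h1' : L.coeff 1 = 1) (hx : ∀ m b : ℕ, W.Rep ((L ^ m).coeff (-((b : ℤ) + 1))) (x m b)) {r : ℕ}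
    (hred : ∀ i : ℤ, i < 0 → (L ^ (r + 1)).coeff i = 0) (m : ℕ) :
    actVec (matR L W.D r) (fun b : Fin r => x m b) = fun b : Fin r => x (m + (r + 1)) b := by
  have hN := coeff_pow_top h1 h1' (r + 1)
  have hS : actVec (matS L V r) (fun b : Fin r => x m b) +
      actVec (matT L V r) (fun b : Fin (r + 1) => x m (r + b)) =
        fun b : Fin r => x (m + (r + 1)) b := by
    ext a
    have h := coeff_pow_add_right h1 hx hred m (a := a) (by omega)
    -- The last index, of depth `2N`, lies outside both blocks; its coefficient is zero because `a <
    -- N - 1`.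
    rw [show 2 * (r + 1) = r + (r + 1) + 1 by ring, sum_range_succ, sum_range_add,
      cCoeff_of_lt (by push_cast; omega), mulOp_zero, ← Fin.sum_univ_eq_sum_range (fun b =>
      mulOp V (cCoeff L (r + 1) (-((a : ℤ) + 1)) ((b : ℤ) - a)) (x m b)),
      ← Fin.sum_univ_eq_sum_range (fun b =>
      mulOp V (cCoeff L (r + 1) (-((a : ℤ) + 1)) (((r + b : ℕ) : ℤ) - a)) (x m (r + b)))] at h
    rw [h]
    change _ = _ + (0 : V)
    rw [add_zero]
    simp only [Nat.cast_add]
    rfl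
  have hM : actVec (matN L W.D r) (fun b : Fin r => x m b) +
      actVec (matM L W.D r) (fun b : Fin (r + 1) => x m (r + b)) = 0 := by
    ext a
    have h := sum_commOp hδI h1 hx hred m (a := a) (by omega)
    -- Here `a = N - 1` also occurs; in that row depth `2N` drops out by cancellation of the leading
    -- ones.
    rw [show 2 * (r + 1) = r + (r + 1) + 1 by ring, sum_range_succ, sum_range_add,
      commOp_add hN (by omega), if_neg (by omega), if_neg (by omega),
      ← Fin.sum_univ_eq_sum_range (fun b => commOp L W.D (r + 1) a b (x m b)),
      ← Fin.sum_univ_eq_sum_range (fun b => commOp L W.D (r + 1) a (r + b) (x m (r + b)))] at h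
    change _ + (0 : V) = 0 at h
    rw [add_zero] at h
    rw [Pi.zero_apply, ← h]
    refine congrArg₂ _ (sum_congr rfl fun b _ => ?_) (sum_congr rfl fun b _ => ?_)
    · rw [commOp_eq_matN]
    · rw [commOp_add hN (by omega), matM, Matrix.of_apply]
      simp only [Fin.ext_iff, Fin.lt_def]
  rw [← hS, matR, actVec_sub, actVec_mul, actVec_mul, eq_neg_of_add_eq_zero_left hM,
    actVec_neg, ← actVec_mul (Ring.inverse _), Ring.inverse_mul_cancel _ (isUnit_matM L
      W.D_bijective r), actVec_one, actVec_neg, sub_neg_eq_add]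

theorem actVec_matPhi (hδI : ∀ f ∈ I, δ f ∈ I) (h1 : ∀ j, 1 < j → L.coeff j = 0)
    (h1' : L.coeff 1 = 1) (hx : ∀ m b : ℕ, W.Rep ((L ^ m).coeff (-((b : ℤ) + 1))) (x m b)) {r : ℕ}
    (hred : ∀ i : ℤ, i < 0 → (L ^ (r + 1)).coeff i = 0) (m : ℕ) :
    actVec (matPhi L W.D r) (actVec (matQ L W.D r) fun b : Fin r => x m b) =
      actVec (matQ L W.D r) fun b : Fin r => x (m + (r + 1)) b := by
  rw [matPhi, ← actVec_mul, Matrix.mul_assoc, Ring.inverse_mul_cancel _ (isUnit_matQ h1'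
    W.D_bijective r), mul_one, actVec_mul, actVec_matR hδI h1 h1' hx hred]

theorem actVec_matPhi_sq (hδI : ∀ f ∈ I, δ f ∈ I) (h1 : ∀ j, 1 < j → L.coeff j = 0)
    (h1' : L.coeff 1 = 1) (hx : ∀ m b : ℕ, W.Rep ((L ^ m).coeff (-((b : ℤ) + 1))) (x m b)) {r : ℕ}
    (hred : ∀ i : ℤ, i < 0 → (L ^ (r + 1)).coeff i = 0) (m : ℕ) :
    actVec (matPhi L W.D r ^ 2) (actVec (matQ L W.D r) fun b : Fin r => x m b) =
      actVec (matQ L W.D r) fun b : Fin r => x (m + 2 * (r + 1)) b := by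
  rw [pow_two, actVec_mul, actVec_matPhi hδI h1 h1' hx hred, actVec_matPhi hδI h1 h1' hx hred,
    two_mul, add_assoc]

/-- The flows are expressed through the negative part of `L^m` by the matrix `Q`. -/
theorem rep_comm_nonnegPart (hδI : ∀ f ∈ I, δ f ∈ I) (h1 : ∀ j, 1 < j → L.coeff j = 0)
    (h1' : L.coeff 1 = 1) (hx : ∀ m b : ℕ, W.Rep ((L ^ m).coeff (-((b : ℤ) + 1))) (x m b)) {r : ℕ}
    (m : ℕ) (a : Fin r) :
    W.Rep (((L ^ m).nonnegPart * L - L * (L ^ m).nonnegPart).coeff (-((a : ℤ) + 1)))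
      (actVec (matQ L W.D r) (fun b : Fin r => x m b) a) := by
  rw [coeff_nonnegPart_comm (M := m) (fun i hi => coeff_pow_eq_zero h1 m hi) h1 h1'
    (PsiDO.pow_mul_self L m)]
  have e : actVec (matQ L W.D r) (fun b : Fin r => x m b) a =
      ∑ b ∈ range (a + 1), oOp L W.D (a + 2) (b + 1) (x m b) := by
    have : ∀ b : Fin r, matQ L W.D r a b (x m b) =
        if (b : ℕ) ≤ a then oOp L W.D (a + 2) (b + 1) (x m b) else 0 := by
      intro b
      rw [matQ, Matrix.of_apply]
      simp only [Fin.le_def]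
      split_ifs <;> rfl
    simp only [actVec, this]
    rw [Fin.sum_univ_eq_sum_range
      (fun b => if b ≤ (a : ℕ) then oOp L W.D (a + 2) (b + 1) (x m b) else 0), ← sum_filter]
    congr 1
    ext b
    simp only [mem_filter, mem_range]
    omega
  rw [e]
  refine NonlocalModule.Rep.sum fun b _ => ?_
  rw [oOp, end_sum_apply]
  refine NonlocalModule.Rep.sum fun i _ => ?_
  refine NonlocalModule.Rep.sub ?_ ?_
  · rw [← smul_mul_assoc]
    exact ((hx m b).iterate hδI _).mul _
  · rw [mul_comm, ← smul_mul_assoc]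
    exact (hx m b).mul _

end Flows

/-! ### Reduction to `u_2, u_4, …` and the main theorem -/

/-- The reduction of the square of `Φ` to the components `u_2, u_4, …`. -/
theorem actVec_matPhiHat {L : PsiDO δ} {D : AddMonoid.End V} {k n : ℕ} {U : Fin (2 * n) → V}
    {Y : Fin n → V} (heven : ∀ μ : Fin n, U ⟨2 * μ, by omega⟩ = Y μ)
    (hodd : ∀ i : Fin n, U ⟨2 * i + 1, by omega⟩ = ∑ μ ∈ Iic i, bOp A D k (i + 1) (μ + 1) (Y μ))
    (a : Fin n) :
    actVec (matPhiHat k L D n) Y a = actVec (matPhi L D (2 * n) ^ 2) U ⟨2 * a, by omega⟩ := by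
  simp only [actVec]
  rw [Fin.sum_univ_two_mul]
  simp only [heven, hodd, map_sum]
  -- Exchanging the sums over `μ ≤ i` collects, for each `μ`, the column contributions with `i ≥ μ`
  -- that define the entry.
  rw [sum_comm' (s' := fun μ : Fin n => Ici μ) (t' := univ) (by simp), ← sum_add_distrib]
  refine sum_congr rfl fun μ _ => ?_
  rw [matPhiHat, Matrix.of_apply]
  refine (AddMonoidHom.add_apply _ _ _).trans (congrArg _ ?_)
  exact end_sum_apply _ _ _

/-- The recursion relation, iterated. -/
theorem actVec_pow_of_recursion {ι : Type*} [Fintype ι] [DecidableEq ι]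
    {M : Matrix ι ι (AddMonoid.End V)} {Y : ℕ → ι → V} {N : ℕ}
    (h : ∀ m, actVec M (Y m) = Y (m + N)) (m p : ℕ) : actVec (M ^ p) (Y m) = Y (m + p * N) := by
  induction p with
  | zero => rw [pow_zero, actVec_one, Nat.zero_mul, Nat.add_zero]
  | succ p ih => rw [pow_succ', actVec_mul, ih, h, add_mul, one_mul, add_assoc]

theorem lax_coeff (u : ℕ → A) (l : ℕ) {j : ℤ} (hj : j + l = 1) :
    (PsiDO.lax δ u).coeff j = u l := by
  change (if j ≤ 1 then u (1 - j).toNat else 0) = u l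
  rw [if_pos (by omega), show (1 - j).toNat = l by omega]

end BCKP

theorem mainTheorem2
    {A : Type*} [CommRing A] [Algebra ℚ A]
    -- the derivation `∂ = ∂/∂x`, and `d m = ∂/∂t_{2m+1}`
    (δ : Derivation ℚ A A) (d : ℕ → Derivation ℚ A A)
    (hcomm : ∀ (m : ℕ) (a : A), d m (δ a) = δ (d m a))
    -- a differential ideal, and a module over it on which `∂` is invertible
    (I : Ideal A) (hδI : ∀ f ∈ I, δ f ∈ I) (hdI : ∀ (m : ℕ), ∀ f ∈ I, d m f ∈ I)
    {V : Type*} [AddCommGroup V] [Module A V] (W : BCKP.NonlocalModule δ I V)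
    -- the Lax operator
    (u : ℕ → A) (hu0 : u 0 = 1) (hu1 : u 1 = 0) (huI : ∀ j : ℕ, 2 ≤ j → u j ∈ I)
    (L : BCKP.PsiDO δ) (hL : L = BCKP.PsiDO.lax δ u)
    -- `k = 0` is the CKP hierarchy and `k = 1` the BKP hierarchy
    (k : ℕ) (hk : k = 0 ∨ k = 1)
    (hadj : L.adjoint = -(BCKP.PsiDO.dpow δ k * L * BCKP.PsiDO.dpow δ (-k)))
    (hflow : ∀ (m : ℕ) (j : ℤ), d m (L.coeff j) =
      ((L ^ (2 * m + 1)).nonnegPart * L - L * (L ^ (2 * m + 1)).nonnegPart).coeff j)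
    -- the `(2n+1)`-reduction
    (n : ℕ) (hred : L ^ (2 * n + 1) = (L ^ (2 * n + 1)).nonnegPart) :
    -- the two inverses in the definition of `Φ(2n+1)` exist
    IsUnit (BCKP.matM L W.D (2 * n)) ∧ IsUnit (BCKP.matQ L W.D (2 * n)) ∧
    ∀ (m p : ℕ) (a : Fin n),
      W.ι ⟨d (m + p * (2 * n + 1)) (u (2 * (a + 1))), hdI _ _ (huI _ (by omega))⟩ =
        ∑ μ : Fin n, (BCKP.matPhiHat k L W.D n ^ p) a μ
          (W.ι ⟨d m (u (2 * (μ + 1))), hdI _ _ (huI _ (by omega))⟩) := by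
  have h1 : ∀ j, 1 < j → L.coeff j = 0 := fun j hj => by rw [hL]; exact if_neg (by omega)
  have hu : ∀ (l : ℕ) (j : ℤ), j + l = 1 → L.coeff j = u l := fun l j hj => by
    rw [hL, BCKP.lax_coeff u l hj]
  have h1' : L.coeff 1 = 1 := by rw [hu 0 1 (by simp), hu0]
  have h0 : L.coeff 0 = 0 := by rw [hu 1 0 (by simp), hu1]
  have hI : ∀ j, j ≠ 1 → L.coeff j ∈ I := by
    intro j hj
    by_cases hj1 : 1 < j
    · rw [h1 j hj1]; exact I.zero_mem
    by_cases hj0 : j = 0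
    · rw [hj0, h0]; exact I.zero_mem
    · rw [hu (1 - j).toNat j (by omega)]
      exact huI _ (by omega)
  refine ⟨BCKP.isUnit_matM L W.D_bijective _, BCKP.isUnit_matQ h1' W.D_bijective _, ?_⟩
  have hred' : ∀ i : ℤ, i < 0 → (L ^ (2 * n + 1)).coeff i = 0 := fun i hi => by
    rw [hred]; exact if_neg (by omega)
  obtain ⟨x, hx⟩ : ∃ x : ℕ → ℕ → V, ∀ m b : ℕ, W.Rep ((L ^ m).coeff (-((b : ℤ) + 1))) (x m b) :=
    ⟨fun m b => W.ι ⟨_, BCKP.coeff_pow_mem hδI h1 h1' hI m (by omega)⟩, fun m b => ⟨_, rfl⟩⟩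
  obtain ⟨Y, hY⟩ : ∃ Y : ℕ → Fin n → V, ∀ m a, Y m a =
    W.ι ⟨d m (u (2 * (a + 1))), hdI _ _ (huI _ (by omega))⟩ := ⟨_, fun _ _ => rfl⟩
  have hYrep : ∀ (m : ℕ) (a : Fin n), W.Rep (d m (u (2 * (a + 1)))) (Y m a) := fun m a => ⟨_, (hY m a).symm⟩
  -- Entry `a`, counted from `0`, belongs to `u_(a+2)`: the even positions carry the independent
  -- `u_2, u_4, …`, the odd ones the dependent `u_3, u_5, …`.
  have hU : ∀ (m : ℕ) (a : Fin (2 * n)), W.Rep (d m (u (a + 2)))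
      (BCKP.actVec (BCKP.matQ L W.D (2 * n)) (fun b : Fin (2 * n) => x (2 * m + 1) b) a) := by
    intro m a
    have := BCKP.rep_comm_nonnegPart hδI h1 h1' hx (2 * m + 1) a
    rwa [← hflow, hu (a + 2) _ (by push_cast; ring)] at this
  have heven : ∀ (m : ℕ) (a : Fin n), BCKP.actVec (BCKP.matQ L W.D (2 * n))
      (fun b : Fin (2 * n) => x (2 * m + 1) b) ⟨2 * a, by omega⟩ = Y m a :=
    fun m a => (hU m _).unique (hYrep m a)
  have hodd : ∀ (m : ℕ) (i : Fin n), BCKP.actVec (BCKP.matQ L W.D (2 * n))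
      (fun b : Fin (2 * n) => x (2 * m + 1) b) ⟨2 * i + 1, by omega⟩ =
        ∑ μ ∈ Finset.Iic i, BCKP.bOp A W.D k (i + 1) (μ + 1) (Y m μ) := by
    intro m i
    refine (hU m _).unique ?_
    -- The time derivations commute with `∂` and with rational constants, so the adjoint constraint
    -- on `u` passes unchanged to its time derivatives.
    have hd : ∀ (j : ℕ) (f : A), d m (δ^[j] f) = δ^[j] (d m f) := fun j f => by
      induction j generalizing f with
      | zero => rfl
      | succ j ih => rw [Function.iterate_succ_apply, ih, hcomm, Function.iterate_succ_apply]
    have e := BCKP.coeff_even_eq h1 h1' h0 hk hadj (i + 1)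
    rw [hu (2 * i + 3) _ (by push_cast; ring)] at e
    change W.Rep (d m (u (2 * i + 3))) _
    rw [e, map_sum]
    have e2 : ∑ μ ∈ Finset.Iic i, BCKP.bOp A W.D k (i + 1) (μ + 1) (Y m μ) =
        ∑ μ : Fin n, if (μ : ℕ) ≤ i then BCKP.bOp A W.D k (i + 1) (μ + 1) (Y m μ) else 0 := by
      rw [← Finset.sum_filter]
      congr 1
      ext μ
      simp
    have e3 : ∑ μ ∈ Finset.range (i + 1), d m (BCKP.bCoeff k (i + 1) (μ + 1) •
        δ^[2 * (i + 1) - 2 * (μ + 1) + 1] (L.coeff (1 - 2 * (μ + 1 : ℕ)))) =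
        ∑ μ : Fin n, if (μ : ℕ) ≤ i then d m (BCKP.bCoeff k (i + 1) (μ + 1) •
        δ^[2 * (i + 1) - 2 * (μ + 1) + 1] (L.coeff (1 - 2 * (μ + 1 : ℕ)))) else 0 := by
      rw [Fin.sum_univ_eq_sum_range (fun μ : ℕ => if μ ≤ i then d m (BCKP.bCoeff k (i + 1) (μ + 1) •
        δ^[2 * (i + 1) - 2 * (μ + 1) + 1] (L.coeff (1 - 2 * (μ + 1 : ℕ)))) else 0),
        ← Finset.sum_filter]
      congr 1
      ext μ
      simp only [Finset.mem_filter, Finset.mem_range]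
      omega
    rw [e2, e3]
    refine BCKP.NonlocalModule.Rep.sum fun μ _ => ?_
    split_ifs
    · rw [hu (2 * (μ + 1)) _ (by push_cast; ring), Derivation.map_smul, hd, Algebra.smul_def]
      exact ((hYrep m μ).iterate hδI _).mul _
    · exact ⟨I.zero_mem, W.ι.map_zero⟩
  have hrec : ∀ m, BCKP.actVec (BCKP.matPhiHat k L W.D n) (Y m) = Y (m + (2 * n + 1)) := by
    intro m
    ext a
    -- Two steps of length `2n + 1` take the odd exponent `2m + 1` to the odd exponent of the flow
    -- `m + (2n + 1)`.
    rw [BCKP.actVec_matPhiHat (heven m) (hodd m), BCKP.actVec_matPhi_sq hδI h1 h1' hx hred',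
      ← heven, show 2 * m + 1 + 2 * (2 * n + 1) = 2 * (m + (2 * n + 1)) + 1 by ring]
  intro m p a
  have := congrFun (BCKP.actVec_pow_of_recursion hrec m p) a
  rw [BCKP.actVec] at this
  simp only [hY] at this
  exact this.symm
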